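/- Let $V=\bigoplus_{p\in\mathbb Z}V^{[p]}$ be a differential graded (dg) vertex operator algebra over $\mathbb C$. That is, $V$ is a cochain complex with differential $d_V$ of degree $1$, with vertex operators $Y(v,x)=\sum_n v_nx^{-n-1}$, where $|x|=-2$ (so $v_n$ has degree $|v|-2n-2$), such that $d_V(v_nw)=(d_Vv)_nw+(-1)^{|v|}v_n(d_Vw)$; with a vacuum $\mathbf 1\in V^{[0]}$, $d_V\mathbf 1=0$, satisfying the truncation, vacuum and creation axioms and the Jacobi identity with Koszul sign $(-1)^{|u||v|}$; and with a conformal vector $\omega\in V^{[4]}$, $d_V\omega=0$, whose modes $L(n)=\omega_{n+1}$ satisfy the Virasoro relations for some central charge, such that $L(-1)v=v_{-2}\mathbf 1$, the operator $L(0)$ is semisimple with eigenspace decomposition $V=\bigoplus_{n\in\frac12\mathbb Z}V_n$, $\dim V_n<\infty$, $V_n=0$ for $n\ll0$, and $\omega\in V_2$. For $u\in V_n$ (write $\mathrm{wt}(u)=n$) and $v\in V$ put $$u\ast v=\sum_{i\ge0}\binom{\mathrm{wt}(u)}{i}u_{i-1}v,\qquad u\circ v=\sum_{i\ge0}\binom{\mathrm{wt}(u)}{i}u_{i-2}v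 .$$ Let $O(V)$ be the span of all $u\circ v$, let $A(V)=V/O(V)$, and write $[v]$ for the class of $v$ in $A(V)$. Let $F^pA(V)$ be the image of $\bigoplus_{q\le p}V^{[q]}$, and let $\mathrm{gr}^{[*]}A(V)=\bigoplus_pF^pA(V)/F^{p-1}A(V)$. For $x\in F^pA(V)$ let $\widetilde x$ be its class in $\mathrm{gr}^{[p]}A(V)=F^pA(V)/F^{p-1}A(V)$. Then $\ast$ and $d_V$ induce well-defined linear operations on $A(V)$, every element of $\mathrm{gr}^{[p]}A(V)$ is of the form $\widetilde{[u]}$ with $u\in V^{[p]}$, and $\mathrm{gr}^{[*]}A(V)$ is a (unital, associative) graded commutative dg Poisson algebra, with unit $\widetilde{[\mathbf 1]}$, for the following well-defined operations. * The product, of degree $0$, is induced by $\ast$: $\widetilde x\ast\widetilde y=\widetilde{x\ast y}$. * The differential, of degree $1$, is induced by $d_V$: $d\,\widetilde x=\widetilde{d_Vx}$. * The Poisson bracket, of degree $-2$, is $$\{\widetilde x,\widetilde y\}=[u]\ast[v]-(-1)^{pq}[v]\ast[u]\ \bmod F^{p+q-3}A(V)\ \in\ \mathrm{gr}^{[p+q-2]}A(V)$$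 for $x\in F^pA(V)$, $y\in F^qA(V)$ and any $u\in V^{[p]}$, $v\in V^{[q]}$ with $[u]-x\in F^{p-1}A(V)$, $[v]-y\in F^{q-1}A(V)$. Here "dg Poisson algebra" means that, for homogeneous elements $a,b,c$: $\{a,b\}=-(-1)^{|a||b|}\{b,a\}$; $\{a,\{b,c\}\}=\{\{a,b\},c\}+(-1)^{|a||b|}\{b,\{a,c\}\}$; $\{a,bc\}=\{a,b\}c+(-1)^{|a||b|}b\{a,c\}$; $d^2=0$; $d(ab)=(da)b+(-1)^{|a|}a\,db$; and $d\{a,b\}=\{da,b\}+(-1)^{|a|}\{a,db\}$. In particular, for all $u\in V^{[p]}$, $v\in V^{[q]}$ with classes $\widetilde x=\widetilde{[u]}\in\mathrm{gr}^{[p]}A(V)$ and $\widetilde y=\widetilde{[v]}\in\mathrm{gr}^{[q]}A(V)$, one has $$\widetilde x\ast\widetilde y=\widetilde{[u_{-1}v]}\in\mathrm{gr}^{[p+q]}A(V),\qquad \{\widetilde x,\widetilde y\}=\widetilde{[u_0v]}\in\mathrm{gr}^{[p+q-2]}A(V).$$ -/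

import Mathlib

open scoped DirectSum

/-- A differential graded vertex algebra over `ℂ` on the vector space `V`. The vertex operator
`Y(v, x) = ∑ v_n x^(-n-1)` is recorded by its modes, `Y v n w = v_n w`; the formal variable `x` has
cohomological degree `-2`. -/
structure DGVertexAlgebra (V : Type*) [AddCommGroup V] [Module ℂ V] where
  /-- the homogeneous component `V^[p]` of cohomological degree `p` -/
  deg : ℤ → Submodule ℂ V
  deg_internal : DirectSum.IsInternal deg
  /-- the differential -/
  d : V →ₗ[ℂ] V
  d_mem : ∀ (p : ℤ), ∀ v ∈ deg p, d v ∈ deg (p + 1)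
  d_d : ∀ v, d (d v) = 0
  /-- the modes of the vertex operator map -/
  Y : V →ₗ[ℂ] (ℤ → Module.End ℂ V)
  /-- the vertex operator map has degree zero -/
  Y_mem : ∀ (p q n : ℤ), ∀ v ∈ deg p, ∀ w ∈ deg q, Y v n w ∈ deg (p + q - 2 * n - 2)
  /-- the vertex operator map commutes with the differentials -/
  d_Y : ∀ (p n : ℤ), ∀ v ∈ deg p, ∀ w,
    d (Y v n w) = Y (d v) n w + (p - 2 * n - 2).negOnePow • Y v n (d w)
  /-- the vacuum vector -/
  vac : V
  vac_mem : vac ∈ deg 0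
  d_vac : d vac = 0
  truncation : ∀ u v, ∃ N : ℤ, ∀ n : ℤ, N ≤ n → Y u n v = 0
  vacuum : ∀ (n : ℤ) (v : V), Y vac n v = if n = -1 then v else 0
  creation : ∀ v, Y v (-1) vac = v ∧ ∀ n : ℤ, 0 ≤ n → Y v n vac = 0
  /-- The Jacobi identity, as the equality of the coefficients of
  `x₀^(-l-1) x₁^(-m-1) x₂^(-n-1)`. All sums are finite by truncation. -/
  jacobi : ∀ (p q l m n : ℤ), ∀ u ∈ deg p, ∀ v ∈ deg q, ∀ w,
    ∑ᶠ i : ℕ, ((-1 : ℤ) ^ i * Ring.choose l i) •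
        (Y u (m + l - i) (Y v (n + i) w)
          - (l + p * q).negOnePow • Y v (n + l - i) (Y u (m + i) w))
      = ∑ᶠ i : ℕ, Ring.choose m i • Y (Y u (l + i) v) (m + n - i) w

/-- A differential graded vertex operator algebra: a dg vertex algebra with a conformal vector
`ω` of cohomological degree `4`; here `L(n) = ω_(n+1)`, and the weights are in `(1/2)ℤ`. -/
structure DGVertexOperatorAlgebra (V : Type*) [AddCommGroup V] [Module ℂ V] extends
    DGVertexAlgebra V where
  /-- the conformal vector -/
  omega : V
  omega_mem : omega ∈ deg 4
  d_omega : d omega = 0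
  /-- the central charge -/
  c : ℂ
  virasoro : ∀ (m n : ℤ) (v : V),
    Y omega (m + 1) (Y omega (n + 1) v) - Y omega (n + 1) (Y omega (m + 1) v)
      = (m - n) • Y omega (m + n + 1) v
        + (if m + n = 0 then ((m : ℂ) ^ 3 - m) / 12 * c else 0) • v
  /-- `V` is the direct sum of the eigenspaces of `L(0)` for the eigenvalues in `(1/2)ℤ` -/
  weight_internal : DirectSum.IsInternal
    (fun k : ℤ => Module.End.eigenspace (Y omega 1) ((k : ℂ) / 2))
  omega_weight : omega ∈ Module.End.eigenspace (Y omega 1) 2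
  weight_finite : ∀ k : ℤ, Module.Finite ℂ (Module.End.eigenspace (Y omega 1) ((k : ℂ) / 2))
  weight_bounded : ∃ N : ℤ, ∀ k : ℤ, k < N →
    Module.End.eigenspace (Y omega 1) ((k : ℂ) / 2) = ⊥
  /-- `L(-1)` is the translation operator `v ↦ v_(-2) 1` -/
  L_neg_one : ∀ v, Y omega 0 v = Y v (-2) vac

/-- A graded commutative (unital, associative) dg Poisson algebra with bracket of degree `r`, on
the graded vector space `⨁ p, G p`. The axioms are stated on homogeneous elements, with
`DirectSum.lof ℂ ℤ G p` the inclusion of the component of degree `p`. -/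
structure DGPoissonAlgebra (G : ℤ → Type*) [∀ p, AddCommGroup (G p)] [∀ p, Module ℂ (G p)]
    (r : ℤ) where
  one : ⨁ p, G p
  mul : (⨁ p, G p) →ₗ[ℂ] (⨁ p, G p) →ₗ[ℂ] (⨁ p, G p)
  bracket : (⨁ p, G p) →ₗ[ℂ] (⨁ p, G p) →ₗ[ℂ] (⨁ p, G p)
  d : (⨁ p, G p) →ₗ[ℂ] (⨁ p, G p)
  one_mem : one ∈ LinearMap.range (DirectSum.lof ℂ ℤ G 0)
  mul_mem : ∀ (p q : ℤ) (x : G p) (y : G q),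
    mul (DirectSum.lof ℂ ℤ G p x) (DirectSum.lof ℂ ℤ G q y)
      ∈ LinearMap.range (DirectSum.lof ℂ ℤ G (p + q))
  bracket_mem : ∀ (p q : ℤ) (x : G p) (y : G q),
    bracket (DirectSum.lof ℂ ℤ G p x) (DirectSum.lof ℂ ℤ G q y)
      ∈ LinearMap.range (DirectSum.lof ℂ ℤ G (p + q + r))
  d_mem : ∀ (p : ℤ) (x : G p),
    d (DirectSum.lof ℂ ℤ G p x) ∈ LinearMap.range (DirectSum.lof ℂ ℤ G (p + 1))
  one_mul : ∀ a, mul one a = a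
  mul_one : ∀ a, mul a one = a
  mul_assoc : ∀ a b c, mul (mul a b) c = mul a (mul b c)
  mul_comm : ∀ (p q : ℤ) (x : G p) (y : G q),
    mul (DirectSum.lof ℂ ℤ G p x) (DirectSum.lof ℂ ℤ G q y)
      = (p * q).negOnePow • mul (DirectSum.lof ℂ ℤ G q y) (DirectSum.lof ℂ ℤ G p x)
  d_d : ∀ a, d (d a) = 0
  d_mul : ∀ (p : ℤ) (x : G p) (b : ⨁ p, G p),
    d (mul (DirectSum.lof ℂ ℤ G p x) b)
      = mul (d (DirectSum.lof ℂ ℤ G p x)) b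
        + p.negOnePow • mul (DirectSum.lof ℂ ℤ G p x) (d b)
  bracket_skew : ∀ (p q : ℤ) (x : G p) (y : G q),
    bracket (DirectSum.lof ℂ ℤ G p x) (DirectSum.lof ℂ ℤ G q y)
      = -(((p + r) * (q + r)).negOnePow •
          bracket (DirectSum.lof ℂ ℤ G q y) (DirectSum.lof ℂ ℤ G p x))
  bracket_jacobi : ∀ (p q : ℤ) (x : G p) (y : G q) (c : ⨁ p, G p),
    bracket (DirectSum.lof ℂ ℤ G p x) (bracket (DirectSum.lof ℂ ℤ G q y) c)
      = bracket (bracket (DirectSum.lof ℂ ℤ G p x) (DirectSum.lof ℂ ℤ G q y)) c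
        + ((p + r) * (q + r)).negOnePow •
          bracket (DirectSum.lof ℂ ℤ G q y) (bracket (DirectSum.lof ℂ ℤ G p x) c)
  bracket_mul : ∀ (p q : ℤ) (x : G p) (y : G q) (c : ⨁ p, G p),
    bracket (DirectSum.lof ℂ ℤ G p x) (mul (DirectSum.lof ℂ ℤ G q y) c)
      = mul (bracket (DirectSum.lof ℂ ℤ G p x) (DirectSum.lof ℂ ℤ G q y)) c
        + ((p + r) * q).negOnePow •
          mul (DirectSum.lof ℂ ℤ G q y) (bracket (DirectSum.lof ℂ ℤ G p x) c)
  d_bracket : ∀ (p : ℤ) (x : G p) (b : ⨁ p, G p),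
    d (bracket (DirectSum.lof ℂ ℤ G p x) b)
      = r.negOnePow • bracket (d (DirectSum.lof ℂ ℤ G p x)) b
        + (p + r).negOnePow • bracket (DirectSum.lof ℂ ℤ G p x) (d b)

namespace DGVertexOperatorAlgebra

variable {V : Type*} [AddCommGroup V] [Module ℂ V] (S : DGVertexOperatorAlgebra V)

/-- The subspace of vectors of weight `k / 2`. -/
noncomputable def weightSpace (k : ℤ) : Submodule ℂ V :=
  Module.End.eigenspace (S.Y S.omega 1) ((k : ℂ) / 2)

/-- `∑ binom(k/2, n) u_(n-1) v`, which is `u ∗ v` for `u` of weight `k / 2`. -/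
noncomputable def zhuStar (k : ℤ) (u v : V) : V :=
  ∑ᶠ n : ℕ, Ring.choose ((k : ℂ) / 2) n • S.Y u ((n : ℤ) - 1) v

/-- `∑ binom(k/2, n) u_(n-2) v`, which is `u ∘ v` for `u` of weight `k / 2`. -/
noncomputable def zhuCirc (k : ℤ) (u v : V) : V :=
  ∑ᶠ n : ℕ, Ring.choose ((k : ℂ) / 2) n • S.Y u ((n : ℤ) - 2) v

/-- The subspace `O(V)`, spanned by all `u ∘ v` with `u` of homogeneous weight. -/
def zhuO : Submodule ℂ V :=
  Submodule.span ℂ {a | ∃ k : ℤ, ∃ u ∈ S.weightSpace k, ∃ v : V, a = S.zhuCirc k u v}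

/-- The space `A(V) = V / O(V)`. -/
abbrev Zhu : Type _ := V ⧸ S.zhuO

/-- The class `[v]` in `A(V)`. -/
def cls : V →ₗ[ℂ] S.Zhu := S.zhuO.mkQ

/-- `F^p A(V)`, the image of `⨁_{q ≤ p} V^[q]`. -/
def zhuF (p : ℤ) : Submodule ℂ S.Zhu :=
  (⨆ q : ℤ, ⨆ _ : q ≤ p, S.deg q).map S.cls

/-- `gr^[p] A(V) = F^p A(V) / F^(p-1) A(V)`. -/
abbrev grZhu (p : ℤ) : Type _ :=
  S.zhuF p ⧸ (S.zhuF (p - 1)).submoduleOf (S.zhuF p)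

/-- The class in `gr^[p] A(V)`, as an element of `gr^[*] A(V) = ⨁ p, gr^[p] A(V)`, of an element
of `F^p A(V)`. -/
noncomputable def symb (p : ℤ) : S.zhuF p →ₗ[ℂ] (⨁ p, S.grZhu p) :=
  DirectSum.lof ℂ ℤ S.grZhu p ∘ₗ ((S.zhuF (p - 1)).submoduleOf (S.zhuF p)).mkQ

/-- The class of `v ∈ V^[p]` lies in `F^p A(V)`. -/
theorem cls_mem {p : ℤ} {v : V} (hv : v ∈ S.deg p) : S.cls v ∈ S.zhuF p :=
  Submodule.mem_map_of_mem
    ((le_iSup₂ (f := fun (q : ℤ) (_ : q ≤ p) => S.deg q) p le_rfl) hv)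

/-- The class of `v ∈ V^[p]` in `gr^[p] A(V)`. -/
noncomputable def symbCls (p : ℤ) (v : S.deg p) : ⨁ p, S.grZhu p :=
  S.symb p ⟨S.cls v, S.cls_mem v.2⟩

end DGVertexOperatorAlgebra

section

open Filter Finset

/-! Everything is expressed by residues Res_x (1+x)^a x^n Y(u,x)v. Since x has degree -2, raising a
mode index by one lowers the cohomological degree by two, so such a residue is u_n v up to lower
filtration (`res_sub_mem_fil`). Hence in gr A(V) the product u∗v becomes u_(-1)v, while u∘v in O(V)
forces u_(-2)v to vanish. Thus gr A(V) is a quotient of Zhu's algebra V/C₂(V), where u_(-1)v, u_0 v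
and d satisfy the dg Poisson axioms by the Jacobi identity (`exists_dgPoissonAlgebra`).
Associativity of ∗ on A(V) itself is never needed.

What remains is descent. O(V) is stable under left ∗-multiplication by b and under Res_x (1+x)^(wt b
- 1) Y(b,x): `res_commutator` turns their commutators with u∘ into residues that `res_mem_zhuO`
places in O(V). Skew-symmetry modulo O(V) (`cls_zres_skew`) identifies the second residue with the
supercommutator for ∗ (`cls_zres_commutator`). This gives stability under multiplication on the
other side, and it explains the bracket: the supercommutator has leading term u_0 v, two degrees
below p+q. -/

theorem finsum_eq_sum_range_of_forall_ge {M : Type*} [AddCommMonoid M] {f : ℕ → M} {N : ℕ}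
    (h : ∀ i, N ≤ i → f i = 0) : ∑ᶠ i, f i = ∑ i ∈ range N, f i := by
  refine finsum_eq_sum_of_support_subset _ fun i hi => ?_
  simp only [coe_range, Set.mem_Iio]
  by_contra hc
  exact hi (h i (not_lt.1 hc))

/-- Double residues involve modes depending only on i + j, so they are collected along
antidiagonals. -/
theorem Finset.sum_range_product_eq_sum_antidiagonal {M : Type*} [AddCommMonoid M] {N : ℕ}
    {f : ℕ → ℕ → M} (h : ∀ i j, N ≤ i + j → f i j = 0) :
    ∑ i ∈ range N, ∑ j ∈ range N, f i j = ∑ s ∈ range N, ∑ x ∈ antidiagonal s, f x.1 x.2 := by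
  rw [← Finset.sum_product', Finset.sum_sigma']
  have key : ∑ x ∈ range N ×ˢ range N, f x.1 x.2
      = ∑ x ∈ (range N ×ˢ range N).filter (fun x => x.1 + x.2 < N), f x.1 x.2 := by
    refine (Finset.sum_filter_of_ne fun x _ hx => ?_).symm
    by_contra hc
    exact hx (h _ _ (not_lt.1 hc))
  rw [key]
  refine Finset.sum_nbij' (fun x => ⟨x.1 + x.2, x⟩) (fun x => x.2) ?_ ?_ ?_ ?_ ?_
  · simp
  · rintro ⟨s, x⟩ hx
    simp only [mem_sigma, mem_range, HasAntidiagonal.mem_antidiagonal] at hx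
    simp only [mem_filter, mem_product, mem_range]
    omega
  · simp
  · rintro ⟨s, x⟩ hx
    simp only [mem_sigma, mem_range, HasAntidiagonal.mem_antidiagonal] at hx
    simp [hx.2]
  · simp

/-! ### Signs, and binomial coefficients at negative integers. -/

theorem Int.cast_negOnePow_smul {V : Type*} [AddCommGroup V] [Module ℂ V] (n : ℤ) (v : V) :
    ((n.negOnePow : ℤ) : ℂ) • v = n.negOnePow • v := by
  rw [Int.cast_smul_eq_zsmul, Units.smul_def]

theorem Submodule.negOnePow_smul_mem {V : Type*} [AddCommGroup V] [Module ℂ V]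
    (P : Submodule ℂ V) (n : ℤ) {v : V} (hv : v ∈ P) : n.negOnePow • v ∈ P := by
  rw [← Int.cast_negOnePow_smul]
  exact P.smul_mem _ hv

theorem LinearMap.map_negOnePow_smul {V W : Type*} [AddCommGroup V] [Module ℂ V]
    [AddCommGroup W] [Module ℂ W] (f : V →ₗ[ℂ] W) (n : ℤ) (v : V) :
    f (n.negOnePow • v) = n.negOnePow • f v := by
  rw [← Int.cast_negOnePow_smul, map_smul, Int.cast_negOnePow_smul]

theorem Int.negOnePow_smul_self {V : Type*} [AddCommGroup V] (n : ℤ) (v : V) :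
    n.negOnePow • n.negOnePow • v = v := by
  rw [smul_smul, ← Int.negOnePow_add, Int.negOnePow_even _ ⟨n, rfl⟩, one_smul]

theorem Ring.choose_neg_one_nat (i : ℕ) : Ring.choose (-1 : ℤ) i = (-1) ^ i := by
  rw [Ring.choose_neg, add_sub_cancel_left, Ring.choose_natCast, Nat.choose_self,
    Units.smul_def, Int.coe_negOnePow_natCast]
  simp

theorem Ring.choose_neg_two_nat (i : ℕ) : Ring.choose (-2 : ℤ) i = (-1) ^ i * (i + 1) := by
  have : (2 : ℤ) + i - 1 = ((i + 1 : ℕ) : ℤ) := by push_cast; ring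
  rw [Ring.choose_neg, this, Ring.choose_natCast, Nat.choose_succ_self_right,
    Units.smul_def, Int.coe_negOnePow_natCast]
  simp

/-! ### Special cases of the Jacobi identity. -/

namespace DGVertexAlgebra

variable {V : Type*} [AddCommGroup V] [Module ℂ V] (A : DGVertexAlgebra V)

/-- The bilinear map `(u, v) ↦ u_n v`. -/
def mode (n : ℤ) : V →ₗ[ℂ] V →ₗ[ℂ] V := LinearMap.proj n ∘ₗ A.Y

@[simp]
theorem mode_apply (n : ℤ) (u v : V) : A.mode n u v = A.Y u n v := rfl

/-- Stated with a filter so that several truncation bounds can be met by one common N. -/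
theorem eventually_Y_eq_zero (u v : V) (n : ℤ) :
    ∀ᶠ N : ℕ in atTop, ∀ i, N ≤ i → A.Y u (n + i) v = 0 := by
  obtain ⟨M, hM⟩ := A.truncation u v
  filter_upwards [eventually_ge_atTop (M - n).toNat] with N hN i hi
  exact hM _ (by omega)

theorem iSup_deg : ⨆ p, A.deg p = ⊤ := A.deg_internal.submodule_iSup_eq_top

/-- A linear identity holds if it holds for vectors of homogeneous cohomological degree. -/
theorem deg_induction {C : V → Prop} (hC : ∀ p, ∀ v ∈ A.deg p, C v) (h0 : C 0)
    (hadd : ∀ u v, C u → C v → C (u + v)) (v : V) : C v :=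
  Submodule.iSup_induction A.deg (motive := C) (by rw [A.iSup_deg]; trivial) hC h0 hadd

theorem commutator {p q : ℤ} {u v : V} (hu : u ∈ A.deg p) (hv : v ∈ A.deg q) (m n : ℤ) (w : V) :
    A.Y u m (A.Y v n w) = (p * q).negOnePow • A.Y v n (A.Y u m w)
      + ∑ᶠ i : ℕ, Ring.choose m i • A.Y (A.Y u i v) (m + n - i) w := by
  have h := A.jacobi p q 0 m n u hu v hv w
  rw [finsum_eq_single _ 0] at h
  · simp only [pow_zero, Ring.choose_zero_right, one_mul, one_smul, Nat.cast_zero, add_zero,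
      sub_zero, zero_add] at h
    rw [← h]
    abel
  · intro i hi
    rw [Ring.choose_zero_pos ℤ (Nat.pos_of_ne_zero hi)]
    simp

/-- Jacobi with m = -1, n = 0 on the vacuum: creation leaves one term on the left. The modes (-1 -
i) at the vacuum play the role of L(-1)^i / i!. -/
theorem skew_symmetry {p q : ℤ} {u v : V} (hu : u ∈ A.deg p) (hv : v ∈ A.deg q) (l : ℤ) :
    A.Y v l u = (p * q + l + 1).negOnePow •
      ∑ᶠ i : ℕ, ((-1 : ℤ) ^ i) • A.Y (A.Y u (l + i) v) (-1 - i) A.vac := by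
  have h := A.jacobi p q l (-1) 0 u hu v hv A.vac
  rw [finsum_eq_single _ 0] at h
  · simp only [pow_zero, Ring.choose_zero_right, one_mul, one_smul, Nat.cast_zero, add_zero,
      sub_zero, zero_add, (A.creation v).2 0 le_rfl, map_zero, (A.creation u).1, zero_sub] at h
    simp only [Ring.choose_neg_one_nat] at h
    rw [← h, smul_neg, Int.negOnePow_succ, Units.neg_smul, neg_neg, add_comm l, smul_smul,
      ← Int.negOnePow_add, Int.negOnePow_even _ ⟨_, rfl⟩, one_smul]
  · intro i hi
    rw [(A.creation v).2 _ (by omega), (A.creation u).2 _ (by omega)]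
    simp

theorem translation (u : V) (n : ℤ) (w : V) :
    A.Y (A.Y u (-2) A.vac) n w = -n • A.Y u (n - 1) w := by
  induction u using A.deg_induction with
  | h0 => simp
  | hadd u v hu hv => simp_all
  | hC p u hu =>
    have h := A.jacobi p 0 (-2) 0 n u hu A.vac A.vac_mem w
    rw [finsum_eq_single (fun i : ℕ => Ring.choose (0 : ℤ) i • _) 0
      (fun i hi => by rw [Ring.choose_zero_pos ℤ (Nat.pos_of_ne_zero hi), zero_smul])] at h
    simp only [Ring.choose_zero_right, one_smul, Nat.cast_zero, add_zero, zero_add, sub_zero,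
      mul_zero, A.vacuum, Ring.choose_neg_two_nat] at h
    rw [← h]
    have hev : (-2 : ℤ).negOnePow = 1 := Int.negOnePow_even _ ⟨-1, rfl⟩
    rw [hev]
    -- Only the mode -1 of the vacuum survives: in the first product at i = -1 - n (needs n < 0), in
    -- the second at i = n - 1 (needs n > 0), and nowhere if n = 0.
    rcases lt_trichotomy n 0 with hn | rfl | hn
    · rw [finsum_eq_single _ (-1 - n).toNat]
      · rw [if_pos (by omega), if_neg (by omega)]
        have e1 : ((-1 - n).toNat : ℤ) = -1 - n := by omega
        rw [e1, ← mul_assoc, ← mul_pow]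
        simp only [mul_neg, mul_one, neg_neg, one_pow, one_mul, smul_zero, sub_zero]
        rw [show -1 - n + 1 = -n by ring, show -2 - (-1 - n) = n - 1 by ring]
      · intro i hi
        rw [if_neg (by omega), if_neg (by omega)]
        simp
    · rw [finsum_eq_zero_of_forall_eq_zero]
      · simp
      · intro i
        rw [if_neg (by omega), if_neg (by omega)]
        simp
    · rw [finsum_eq_single _ (n - 1).toNat]
      · rw [if_neg (by omega), if_pos (by omega)]
        have e1 : ((n - 1).toNat : ℤ) = n - 1 := by omega
        rw [e1, ← mul_assoc, ← mul_pow]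
        simp
      · intro i hi
        rw [if_neg (by omega), if_neg (by omega)]
        simp

theorem Y_Y_neg_one {p q : ℤ} {u v : V} (hu : u ∈ A.deg p) (hv : v ∈ A.deg q) (w : V) :
    A.Y (A.Y u (-1) v) (-1) w = ∑ᶠ i : ℕ, (A.Y u (-1 - i) (A.Y v (-1 + i) w)
      + (p * q).negOnePow • A.Y v (-2 - i) (A.Y u i w)) := by
  have h := A.jacobi p q (-1) 0 (-1) u hu v hv w
  rw [finsum_eq_single (fun i : ℕ => Ring.choose (0 : ℤ) i • _) 0
      (fun i hi => by rw [Ring.choose_zero_pos ℤ (Nat.pos_of_ne_zero hi), zero_smul])] at h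
  simp only [Ring.choose_zero_right, one_smul, Nat.cast_zero, add_zero, zero_add, sub_zero,
    Ring.choose_neg_one_nat, ← mul_pow] at h
  rw [← h]
  refine finsum_congr fun i => ?_
  rw [Int.negOnePow_add, Int.negOnePow_neg, Int.negOnePow_one]
  simp [sub_eq_add_neg]

end DGVertexAlgebra

/-! ### Binomial sums behind the commutator of two residues. -/

/-- Vandermonde splits choose (m + i) t; each choose i r is absorbed into choose a i, giving choose
a r * choose (a - r) (i - r); Vandermonde then sums over i. -/
theorem Ring.sum_antidiagonal_choose_mul_choose_add (a b m : ℂ) (t s : ℕ) :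
    ∑ x ∈ antidiagonal s, Ring.choose a x.1 * Ring.choose b x.2 * Ring.choose (m + x.1) t
      = ∑ r ∈ range (t + 1), Ring.choose m (t - r) * Ring.choose a r *
          (if r ≤ s then Ring.choose (a + b - r) (s - r) else 0) := by
  have h1 : ∀ i : ℕ, Ring.choose (m + i) t
      = ∑ r ∈ range (t + 1), Ring.choose (i : ℂ) r * Ring.choose m (t - r) := by
    intro i
    rw [add_comm, Ring.add_choose_eq t (Commute.all _ _),
      Finset.Nat.sum_antidiagonal_eq_sum_range_succ
        (fun x y => Ring.choose (i : ℂ) x * Ring.choose m y)]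
  have h2 : ∀ i r : ℕ, Ring.choose a i * Ring.choose (i : ℂ) r
      = if r ≤ i then Ring.choose a r * Ring.choose (a - r) (i - r) else 0 := by
    intro i r
    rw [Ring.choose_natCast]
    split_ifs with h
    · rw [← Ring.choose_smul_choose a h, nsmul_eq_mul, mul_comm]
    · rw [Nat.choose_eq_zero_of_lt (not_le.1 h)]
      simp
  simp only [h1, Finset.mul_sum]
  rw [Finset.sum_comm]
  refine Finset.sum_congr rfl fun r _ => ?_
  rw [Finset.Nat.sum_antidiagonal_eq_sum_range_succ
    (fun x y => Ring.choose a x * Ring.choose b y * (Ring.choose (x : ℂ) r * Ring.choose m (t - r)))]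
  have h3 : ∀ i, Ring.choose a i * Ring.choose b (s - i) *
      (Ring.choose (i : ℂ) r * Ring.choose m (t - r))
      = Ring.choose m (t - r) * Ring.choose a r *
        (if r ≤ i then Ring.choose (a - r) (i - r) * Ring.choose b (s - i) else 0) := by
    intro i
    have := h2 i r
    split_ifs at this ⊢
    · linear_combination Ring.choose b (s - i) * Ring.choose m (t - r) * this
    · linear_combination Ring.choose b (s - i) * Ring.choose m (t - r) * this
  simp only [h3, ← Finset.mul_sum]
  congr 1
  rw [← Finset.sum_filter]
  have h4 : (range s.succ).filter (fun i => r ≤ i) = Ico r (s + 1) := by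
    ext i; simp; omega
  rw [h4, Finset.sum_Ico_eq_sum_range]
  split_ifs with h
  · rw [show a + b - r = (a - r) + b by ring, Ring.add_choose_eq _ (Commute.all _ _),
      Finset.Nat.sum_antidiagonal_eq_sum_range_succ
        (fun x y => Ring.choose (a - r) x * Ring.choose b y), show s + 1 - r = (s - r).succ by omega]
    refine Finset.sum_congr rfl fun i _ => ?_
    rw [Nat.add_sub_cancel_left, Nat.sub_add_eq]
  · rw [show s + 1 - r = 0 by omega, Finset.sum_range_zero]

theorem Ring.choose_eq_neg_one_pow_mul_choose (a : ℂ) (n : ℕ) :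
    Ring.choose a n = (-1) ^ n * Ring.choose (n - 1 - a) n := by
  have h := Ring.choose_neg (-a) n
  rw [neg_neg] at h
  rw [h, ← Int.cast_negOnePow_smul, Int.coe_negOnePow_natCast, smul_eq_mul,
    show -a + n - 1 = n - 1 - a by ring]
  simp

theorem Ring.succ_mul_choose_succ (a : ℂ) (n : ℕ) :
    ((n : ℂ) + 1) * Ring.choose a (n + 1) = a * Ring.choose (a - 1) n := by
  have h := Ring.choose_smul_choose a (show 1 ≤ n + 1 by omega)
  rw [Nat.choose_one_right, Ring.choose_one_right, nsmul_eq_mul, Nat.add_sub_cancel] at h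
  exact_mod_cast h

/-- Leibniz rule for the t-th divided derivative of (1+x)^a x^m: r derivatives fall on (1+x)^a and t
- r on x^m, and the result is multiplied by (1+x)^b x^n. -/
theorem sum_range_range_choose_smul {V : Type*} [AddCommGroup V] [Module ℂ V] (a b : ℂ) (m : ℤ)
    (n : ℤ) (t : ℕ) (F : ℤ → V) (J : ℤ) (hF : ∀ j, J ≤ j → F j = 0) :
    ∀ᶠ N : ℕ in atTop,
      ∑ i ∈ range N, ∑ j ∈ range N, (Ring.choose a i * Ring.choose b j) •
          Ring.choose (m + i) t • F (m + i + (n + j) - t)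
        = ∑ r ∈ range (t + 1), (Ring.choose (m : ℂ) (t - r) * Ring.choose a r) •
            ∑ᶠ s : ℕ, Ring.choose (a + b - r) s • F (m + n + r - t + s) := by
  filter_upwards [eventually_ge_atTop ((J - (m + n - t)).toNat + t + 1)] with N hN
  have h0 : ∀ i : ℕ, ∀ x : V, Ring.choose (m + i) t • x = Ring.choose ((m : ℂ) + i) t • x := by
    intro i x
    have := Ring.map_choose (Int.castRingHom ℂ) (m + i) t
    simp only [eq_intCast, Int.cast_add, Int.cast_natCast] at this
    rw [← this, Int.cast_smul_eq_zsmul]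
  simp only [h0, smul_smul]
  rw [Finset.sum_range_product_eq_sum_antidiagonal
    (f := fun i j => (Ring.choose a i * Ring.choose b j * Ring.choose ((m : ℂ) + i) t) •
      F (m + i + (n + j) - t))
    (fun i j hij => by rw [hF _ (by omega), smul_zero])]
  have h1 : ∀ s, ∑ x ∈ antidiagonal s, (Ring.choose a x.1 * Ring.choose b x.2 *
      Ring.choose ((m : ℂ) + x.1) t) • F (m + x.1 + (n + x.2) - t)
      = ∑ r ∈ range (t + 1), (Ring.choose (m : ℂ) (t - r) * Ring.choose a r) •
        (if r ≤ s then Ring.choose (a + b - r) (s - r) • F (m + n - t + s) else 0) := by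
    intro s
    have : ∀ x ∈ antidiagonal s, (Ring.choose a x.1 * Ring.choose b x.2 *
      Ring.choose ((m : ℂ) + x.1) t) • F (m + x.1 + (n + x.2) - t)
      = (Ring.choose a x.1 * Ring.choose b x.2 *
      Ring.choose ((m : ℂ) + x.1) t) • F (m + n - t + s) := by
      intro x hx
      rw [HasAntidiagonal.mem_antidiagonal] at hx
      rw [← hx]
      congr 2
      push_cast
      ring
    rw [Finset.sum_congr rfl this, ← Finset.sum_smul,
      Ring.sum_antidiagonal_choose_mul_choose_add, Finset.sum_smul]
    refine Finset.sum_congr rfl fun r _ => ?_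
    rw [← smul_smul, ite_smul, zero_smul]
  simp only [h1]
  rw [Finset.sum_comm]
  refine Finset.sum_congr rfl fun r hr => ?_
  rw [← Finset.smul_sum]
  congr 1
  rw [mem_range] at hr
  rw [finsum_eq_sum_range_of_forall_ge (N := N - r)
    (fun i hi => by rw [hF _ (by omega), smul_zero]), ← Finset.sum_filter]
  have h4 : (range N).filter (fun i => r ≤ i) = Ico r N := by
    ext i; simp; omega
  rw [h4, Finset.sum_Ico_eq_sum_range]
  refine Finset.sum_congr rfl fun i _ => ?_
  rw [Nat.add_sub_cancel_left]
  congr 2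
  push_cast
  ring

/-! ### Residues of vertex operators. -/

namespace DGVertexAlgebra

variable {V : Type*} [AddCommGroup V] [Module ℂ V] (A : DGVertexAlgebra V)

/-- `Res_x (1 + x)^a x^n Y(u, x) v`, as a bilinear map in `u` and `v`. -/
noncomputable def res (a : ℂ) (n : ℤ) : V →ₗ[ℂ] V →ₗ[ℂ] V :=
  LinearMap.mk₂ ℂ (fun u v => ∑ᶠ i : ℕ, Ring.choose a i • A.Y u (n + i) v)
    (by
      intro u u' v
      obtain ⟨N, h, h'⟩ := ((A.eventually_Y_eq_zero u v n).and
        (A.eventually_Y_eq_zero u' v n)).exists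
      rw [finsum_eq_sum_range_of_forall_ge (N := N) (fun i hi => by simp [h i hi, h' i hi]),
        finsum_eq_sum_range_of_forall_ge (N := N) (fun i hi => by simp [h i hi]),
        finsum_eq_sum_range_of_forall_ge (N := N) (fun i hi => by simp [h' i hi]),
        ← Finset.sum_add_distrib]
      simp)
    (by
      intro c u v
      rw [smul_finsum]
      simp [smul_comm c])
    (by
      intro u v v'
      obtain ⟨N, h, h'⟩ := ((A.eventually_Y_eq_zero u v n).and
        (A.eventually_Y_eq_zero u v' n)).exists
      rw [finsum_eq_sum_range_of_forall_ge (N := N) (fun i hi => by simp [h i hi, h' i hi]),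
        finsum_eq_sum_range_of_forall_ge (N := N) (fun i hi => by simp [h i hi]),
        finsum_eq_sum_range_of_forall_ge (N := N) (fun i hi => by simp [h' i hi]),
        ← Finset.sum_add_distrib]
      simp)
    (by
      intro c u v
      rw [smul_finsum]
      simp [smul_comm c])

theorem res_apply (a : ℂ) (n : ℤ) (u v : V) :
    A.res a n u v = ∑ᶠ i : ℕ, Ring.choose a i • A.Y u (n + i) v := rfl

theorem eventually_res (a : ℂ) (n : ℤ) (u v : V) :
    ∀ᶠ N : ℕ in atTop, A.res a n u v = ∑ i ∈ range N, Ring.choose a i • A.Y u (n + i) v := by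
  filter_upwards [A.eventually_Y_eq_zero u v n] with N h
  exact finsum_eq_sum_range_of_forall_ge (fun i hi => by simp [h i hi])

theorem res_add_one (a : ℂ) (n : ℤ) (u v : V) :
    A.res (a + 1) n u v = A.res a n u v + A.res a (n + 1) u v := by
  obtain ⟨N, h1, h2, h3⟩ := (((tendsto_add_atTop_nat 1).eventually
    (A.eventually_res (a + 1) n u v)).and (((tendsto_add_atTop_nat 1).eventually
    (A.eventually_res a n u v)).and (A.eventually_res a (n + 1) u v))).exists
  rw [h1, h2, h3, Finset.sum_range_succ', Finset.sum_range_succ', add_right_comm,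
    ← Finset.sum_add_distrib]
  simp only [Ring.choose_zero_right]
  congr 1
  refine Finset.sum_congr rfl fun i _ => ?_
  rw [Ring.choose_succ_succ, add_smul, add_comm]
  congr 3
  push_cast
  ring_nf

/-- The modes of `L(-1) u = u_(-2) 1` integrated by parts. -/
theorem res_translation (a : ℂ) (n : ℤ) (u v : V) :
    A.res (a + 1) n (A.Y u (-2) A.vac) v
      = -(n : ℂ) • A.res (a + 1) (n - 1) u v - (a + 1) • A.res a n u v := by
  obtain ⟨N, h1, h2, h3⟩ := (((tendsto_add_atTop_nat 1).eventually
    (A.eventually_res (a + 1) n (A.Y u (-2) A.vac) v)).and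
    (((tendsto_add_atTop_nat 1).eventually
    (A.eventually_res (a + 1) (n - 1) u v)).and (A.eventually_res a n u v))).exists
  have e : ∀ i : ℕ, Ring.choose (a + 1) i • A.Y (A.Y u (-2) A.vac) (n + i) v
      = -(n : ℂ) • Ring.choose (a + 1) i • A.Y u (n - 1 + i) v
        - ((i : ℂ) * Ring.choose (a + 1) i) • A.Y u (n - 1 + i) v := by
    intro i
    rw [A.translation, show n + (i : ℤ) - 1 = n - 1 + i by ring, ← Int.cast_smul_eq_zsmul ℂ]
    push_cast
    module
  rw [h1, h2, h3]
  simp only [e]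
  rw [Finset.sum_sub_distrib, ← Finset.smul_sum]
  congr 1
  rw [Finset.sum_range_succ', Finset.smul_sum]
  simp only [Nat.cast_zero, zero_mul, zero_smul, add_zero]
  refine Finset.sum_congr rfl fun i _ => ?_
  rw [Nat.cast_add, Nat.cast_one, Ring.succ_mul_choose_succ, add_sub_cancel_right, smul_smul]
  congr 3
  push_cast
  ring_nf

/-- The outer truncation bound depends on j, so the inner sum is first cut at a fixed M; the
finitely many remaining j then share one bound. -/
theorem eventually_res_res (a a' : ℂ) (m n : ℤ) (b u v : V) :
    ∀ᶠ N : ℕ in atTop, A.res a m b (A.res a' n u v) = ∑ i ∈ range N, ∑ j ∈ range N,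
      (Ring.choose a i * Ring.choose a' j) • A.Y b (m + i) (A.Y u (n + j) v) := by
  obtain ⟨M, h1, h2⟩ := ((A.eventually_res a' n u v).and
    (A.eventually_Y_eq_zero u v n)).exists
  have h3 : ∀ᶠ N : ℕ in atTop, ∀ j ∈ range M, A.res a m b (A.Y u (n + j) v)
      = ∑ i ∈ range N, Ring.choose a i • A.Y b (m + i) (A.Y u (n + j) v) :=
    (Filter.eventually_all_finset _).2 fun j _ => A.eventually_res a m b _
  filter_upwards [h3, eventually_ge_atTop M] with N h3 hN
  rw [h1, map_sum, Finset.sum_comm, ← Finset.sum_subset (Finset.range_mono hN)]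
  · refine Finset.sum_congr rfl fun j hj => ?_
    rw [map_smul, h3 j hj, Finset.smul_sum]
    refine Finset.sum_congr rfl fun i _ => ?_
    rw [smul_smul, mul_comm]
  · intro j _ hj
    rw [mem_range, not_lt] at hj
    simp [h2 j hj]

theorem res_commutator {p q : ℤ} {b u : V} (hb : b ∈ A.deg p) (hu : u ∈ A.deg q)
    (a a' : ℂ) (m n : ℤ) (v : V) :
    A.res a m b (A.res a' n u v) = (p * q).negOnePow • A.res a' n u (A.res a m b v)
      + ∑ᶠ t : ℕ, ∑ r ∈ range (t + 1), (Ring.choose (m : ℂ) (t - r) * Ring.choose a r) •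
          A.res (a + a' - r) (m + n + r - t) (A.Y b t u) v := by
  obtain ⟨T, hT⟩ := (A.eventually_Y_eq_zero b u 0).exists
  simp only [zero_add] at hT
  have hev : ∀ᶠ N : ℕ in atTop, ∀ t ∈ range T,
      ∑ i ∈ range N, ∑ j ∈ range N, (Ring.choose a i * Ring.choose a' j) •
          Ring.choose (m + i) t • A.Y (A.Y b t u) (m + i + (n + j) - t) v
        = ∑ r ∈ range (t + 1), (Ring.choose (m : ℂ) (t - r) * Ring.choose a r) •
            A.res (a + a' - r) (m + n + r - t) (A.Y b t u) v := by
    refine (Filter.eventually_all_finset _).2 fun t _ => ?_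
    obtain ⟨J, hJ⟩ := A.truncation (A.Y b t u) v
    exact sum_range_range_choose_smul a a' m n t (fun j => A.Y (A.Y b t u) j v) J hJ
  obtain ⟨N, h0, h1, h2⟩ := (hev.and ((A.eventually_res_res a a' m n b u v).and
    (A.eventually_res_res a' a n m u b v))).exists
  rw [h1, h2, finsum_eq_sum_range_of_forall_ge (N := T) (fun t ht => by simp [hT t ht]),
    ← Finset.sum_congr rfl h0, Finset.sum_comm (s := range N) (t := range N)
      (f := fun i j => (Ring.choose a' i * Ring.choose a j) • A.Y u (n + i) (A.Y b (m + j) v)),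
    Finset.sum_comm (s := range T), Finset.smul_sum, ← Finset.sum_add_distrib]
  refine Finset.sum_congr rfl fun i _ => ?_
  rw [Finset.sum_comm (s := range T), Finset.smul_sum, ← Finset.sum_add_distrib]
  refine Finset.sum_congr rfl fun j _ => ?_
  rw [A.commutator hb hu, smul_add, mul_comm (Ring.choose a' j), ← Int.cast_negOnePow_smul,
    ← Int.cast_negOnePow_smul, smul_comm]
  congr 1
  rw [finsum_eq_sum_range_of_forall_ge (N := T) (fun t ht => by simp [hT t ht]), Finset.smul_sum]

end DGVertexAlgebra

theorem Submodule.finsum_mem_of_forall {V : Type*} [AddCommGroup V] [Module ℂ V]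
    (P : Submodule ℂ V) {f : ℕ → V} (h : ∀ i, f i ∈ P) : ∑ᶠ i, f i ∈ P :=
  finsum_induction (· ∈ P) (zero_mem _) (fun _ _ => add_mem) h

/-! ### Filtration and projections by cohomological degree. -/

namespace DGVertexAlgebra

variable {V : Type*} [AddCommGroup V] [Module ℂ V] (A : DGVertexAlgebra V)

/-- The vectors of cohomological degree at most `p`. -/
def fil (p : ℤ) : Submodule ℂ V := ⨆ q : ℤ, ⨆ _ : q ≤ p, A.deg q

theorem mem_fil {p q : ℤ} (h : q ≤ p) {v : V} (hv : v ∈ A.deg q) : v ∈ A.fil p :=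
  (le_iSup₂ (f := fun (q : ℤ) (_ : q ≤ p) => A.deg q) q h) hv

theorem fil_mono {p q : ℤ} (h : p ≤ q) : A.fil p ≤ A.fil q :=
  iSup₂_le fun _ hr _ hv => A.mem_fil (hr.trans h) hv

theorem fil_induction {p : ℤ} {C : V → Prop} (hC : ∀ q, q ≤ p → ∀ v ∈ A.deg q, C v) (h0 : C 0)
    (hadd : ∀ u v, C u → C v → C (u + v)) {v : V} (hv : v ∈ A.fil p) : C v := by
  refine Submodule.iSup_induction _ (motive := C) hv (fun q x hx => ?_) h0 hadd
  by_cases h : q ≤ p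
  · rw [iSup_pos h] at hx
    exact hC q h x hx
  · rw [iSup_neg h, Submodule.mem_bot] at hx
    rwa [hx]

theorem exists_deg_add_fil {p : ℤ} {v : V} (hv : v ∈ A.fil p) :
    ∃ u ∈ A.deg p, v - u ∈ A.fil (p - 1) := by
  refine A.fil_induction (C := fun v => ∃ u ∈ A.deg p, v - u ∈ A.fil (p - 1)) ?_ ?_ ?_ hv
  · intro q hq x hx
    rcases hq.eq_or_lt with rfl | hq
    · exact ⟨x, hx, by simp⟩
    · exact ⟨0, zero_mem _, by rw [sub_zero]; exact A.mem_fil (by omega) hx⟩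
  · exact ⟨0, zero_mem _, by simp⟩
  · rintro u v ⟨u', hu', h⟩ ⟨v', hv', h'⟩
    exact ⟨u' + v', add_mem hu' hv', by rw [add_sub_add_comm]; exact add_mem h h'⟩

/-- The term u_(n+i) v has degree p + q - 2(n + i) - 2, so only i = 0 reaches the top degree, and
its coefficient is 1 whatever a is. -/
theorem res_sub_mem_fil {p q r : ℤ} {u v : V} (hu : u ∈ A.deg p) (hv : v ∈ A.deg q) (a : ℂ)
    (n : ℤ) (hr : p + q - 2 * n - 4 ≤ r) : A.res a n u v - A.Y u n v ∈ A.fil r := by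
  obtain ⟨N, h⟩ := ((tendsto_add_atTop_nat 1).eventually (A.eventually_res a n u v)).exists
  rw [h, Finset.sum_range_succ']
  simp only [Ring.choose_zero_right, one_smul, Nat.cast_zero, add_zero, add_sub_cancel_right]
  exact Submodule.sum_mem _ fun i _ =>
    Submodule.smul_mem _ _ (A.mem_fil (by push_cast; omega) (A.Y_mem p q _ u hu v hv))

theorem d_res {p : ℤ} {u : V} (hu : u ∈ A.deg p) (a : ℂ) (n : ℤ) (v : V) :
    A.d (A.res a n u v) = A.res a n (A.d u) v + p.negOnePow • A.res a n u (A.d v) := by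
  obtain ⟨N, h, h', h''⟩ := ((A.eventually_res a n u v).and
    ((A.eventually_res a n (A.d u) v).and (A.eventually_res a n u (A.d v)))).exists
  rw [h, h', h'', map_sum, Finset.smul_sum, ← Finset.sum_add_distrib]
  refine Finset.sum_congr rfl fun i _ => ?_
  rw [map_smul, A.d_Y p _ u hu, smul_add, ← Int.cast_negOnePow_smul, ← Int.cast_negOnePow_smul,
    smul_comm, show p - 2 * (n + i) - 2 = p + 2 * (-(n + i) - 1) by ring, Int.negOnePow_add,
    Int.negOnePow_two_mul, mul_one]

/-- The decomposition of `V` into its components of homogeneous cohomological degree. -/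
noncomputable def degEquiv : (⨁ p, A.deg p) ≃ₗ[ℂ] V :=
  LinearEquiv.ofBijective (DirectSum.coeLinearMap A.deg) (by exact A.deg_internal)

theorem degEquiv_symm_of_mem {p : ℤ} {v : V} (hv : v ∈ A.deg p) :
    A.degEquiv.symm v = DirectSum.lof ℂ ℤ (fun p => A.deg p) p ⟨v, hv⟩ := by
  rw [LinearEquiv.symm_apply_eq]
  exact (DirectSum.coeLinearMap_lof A.deg p ⟨v, hv⟩).symm

/-- The projection to the component of cohomological degree `p`. -/
noncomputable def degProj (p : ℤ) : V →ₗ[ℂ] V :=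
  (A.deg p).subtype ∘ₗ DirectSum.component ℂ ℤ (fun p => A.deg p) p ∘ₗ A.degEquiv.symm.toLinearMap

theorem degProj_mem (p : ℤ) (v : V) : A.degProj p v ∈ A.deg p := Submodule.coe_mem _

theorem degProj_of_mem {p : ℤ} {v : V} (hv : v ∈ A.deg p) : A.degProj p v = v := by
  simp [degProj, A.degEquiv_symm_of_mem hv, DirectSum.component.lof_self]

theorem degProj_of_mem_ne {p q : ℤ} {v : V} (hv : v ∈ A.deg q) (h : q ≠ p) :
    A.degProj p v = 0 := by
  simp [degProj, A.degEquiv_symm_of_mem hv, DirectSum.component.of, h]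

/-- A predicate compatible with addition holds for `v` if it holds for its components. -/
theorem degProj_induction {C : V → Prop} (h0 : C 0) (hadd : ∀ u v, C u → C v → C (u + v))
    (v : V) (hv : ∀ p, C (A.degProj p v)) : C v := by
  classical
  have hsum : v = ∑ᶠ p, A.degProj p v := by
    -- Finiteness of the support is carried along because additivity of the finite sum needs it.
    have : (∀ v, (Function.support fun p => A.degProj p v).Finite ∧
        v = ∑ᶠ p, A.degProj p v) := by
      intro v
      induction v using A.deg_induction with
      | h0 => simp
      | hadd u v hu hv =>
        simp only [map_add]
        refine ⟨(hu.1.union hv.1).subset (Function.support_add _ _), ?_⟩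
        rw [finsum_add_distrib hu.1 hv.1, ← hu.2, ← hv.2]
      | hC p v hv =>
        refine ⟨(Set.finite_singleton p).subset fun q hq => ?_, ?_⟩
        · by_contra hne
          exact hq (A.degProj_of_mem_ne hv fun h => hne h.symm)
        · rw [finsum_eq_single _ p fun q hq => A.degProj_of_mem_ne hv hq.symm,
            A.degProj_of_mem hv]
    exact (this v).2
  rw [hsum]
  exact finsum_induction C h0 hadd hv

theorem degProj_comp_of_map_deg (f : V →ₗ[ℂ] V) (hf : ∀ p, ∀ v ∈ A.deg p, f v ∈ A.deg p)
    (p : ℤ) (v : V) : A.degProj p (f v) = f (A.degProj p v) := by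
  induction v using A.deg_induction with
  | h0 => simp
  | hadd u v hu hv => simp [hu, hv]
  | hC q v hv =>
    by_cases h : q = p
    · subst h
      rw [A.degProj_of_mem hv, A.degProj_of_mem (hf _ _ hv)]
    · rw [A.degProj_of_mem_ne hv h, A.degProj_of_mem_ne (hf _ _ hv) h, map_zero]

end DGVertexAlgebra

/-! ### Weights and residues in O(V). -/

namespace DGVertexOperatorAlgebra

variable {V : Type*} [AddCommGroup V] [Module ℂ V] (S : DGVertexOperatorAlgebra V)

theorem mem_weightSpace {k : ℤ} {v : V} :
    v ∈ S.weightSpace k ↔ S.Y S.omega 1 v = ((k : ℂ) / 2) • v :=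
  Module.End.mem_eigenspace_iff

/-- L(0) = ω_1 has degree 4 - 2 - 2 = 0, so it commutes with the degree projections and the two
gradings are compatible. -/
theorem degProj_mem_weightSpace {k : ℤ} {v : V} (hv : v ∈ S.weightSpace k) (p : ℤ) :
    S.degProj p v ∈ S.weightSpace k := by
  rw [mem_weightSpace] at hv ⊢
  rw [← S.degProj_comp_of_map_deg (S.Y S.omega 1), hv, map_smul]
  intro q w hw
  have := S.Y_mem 4 q 1 _ S.omega_mem w hw
  rwa [show 4 + q - 2 * 1 - 2 = q by ring] at this

theorem weight_induction {C : V → Prop} (hC : ∀ k, ∀ v ∈ S.weightSpace k, C v) (h0 : C 0)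
    (hadd : ∀ u v, C u → C v → C (u + v)) (v : V) : C v :=
  Submodule.iSup_induction S.weightSpace (motive := C)
    (by rw [show ⨆ k, S.weightSpace k = ⊤ from S.weight_internal.submodule_iSup_eq_top]; trivial)
    hC h0 hadd

theorem weight_deg_induction {k : ℤ} {C : V → Prop}
    (hC : ∀ p, ∀ v ∈ S.weightSpace k, v ∈ S.deg p → C v) (h0 : C 0)
    (hadd : ∀ u v, C u → C v → C (u + v)) {v : V} (hv : v ∈ S.weightSpace k) : C v :=
  S.degProj_induction h0 hadd v fun p =>
    hC p _ (S.degProj_mem_weightSpace hv p) (S.degProj_mem p v)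

theorem deg_weight_induction {p : ℤ} {C : V → Prop}
    (hC : ∀ k, ∀ v ∈ S.weightSpace k, v ∈ S.deg p → C v) (h0 : C 0)
    (hadd : ∀ u v, C u → C v → C (u + v)) {v : V} (hv : v ∈ S.deg p) : C v := by
  suffices ∀ w, C (S.degProj p w) by simpa only [S.degProj_of_mem hv] using this v
  intro w
  induction w using S.weight_induction with
  | h0 => rwa [map_zero]
  | hadd u v hu hv => rw [map_add]; exact hadd _ _ hu hv
  | hC k v hv => exact hC k _ (S.degProj_mem_weightSpace hv p) (S.degProj_mem p v)

theorem vac_mem_weightSpace : S.vac ∈ S.weightSpace 0 := by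
  rw [mem_weightSpace, (S.creation S.omega).2 1 zero_le_one]
  simp

theorem Y_mem_weightSpace {k l : ℤ} {u v : V} (hu : u ∈ S.weightSpace k)
    (hv : v ∈ S.weightSpace l) (n : ℤ) : S.Y u n v ∈ S.weightSpace (k + l - 2 * n - 2) := by
  refine S.weight_deg_induction (C := fun u => S.Y u n v ∈ S.weightSpace (k + l - 2 * n - 2))
    ?_ ?_ ?_ hu
  · intro p u hu hp
    rw [mem_weightSpace] at hu hv ⊢
    -- In the commutator with ω_1 only i = 0 and i = 1 survive, contributing L(-1)u and L(0)u; no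
    -- sign appears as ω has even degree.
    rw [S.commutator S.omega_mem hp, hv, finsum_eq_sum_range_of_forall_ge (N := 2)]
    · rw [Finset.sum_range_succ, Finset.sum_range_one]
      simp only [Nat.cast_zero, Nat.cast_one, Ring.choose_zero_right, Ring.choose_one_right,
        one_smul, sub_zero]
      rw [S.L_neg_one, S.translation, hu, show 4 * p = 2 * (2 * p) by ring,
        Int.negOnePow_two_mul, one_smul, show 1 + n - 1 = n by ring, ← Int.cast_smul_eq_zsmul ℂ]
      simp only [map_smul, LinearMap.smul_apply, Pi.smul_apply]
      push_cast
      module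
    · intro i hi
      rw [show (1 : ℤ) = ((1 : ℕ) : ℤ) by norm_num, Ring.choose_natCast,
        Nat.choose_eq_zero_of_lt hi]
      simp
  · simp
  · intro u u' h h'
    simpa using add_mem h h'

/-- `u ↦ Res_x (1 + x)^(wt(u) + a) x^n Y(u, x) v`, extended bilinearly. -/
noncomputable def zres (a : ℂ) (n : ℤ) : V →ₗ[ℂ] V →ₗ[ℂ] V :=
  DirectSum.toModule ℂ ℤ (V →ₗ[ℂ] V)
      (fun k : ℤ => S.res ((k : ℂ) / 2 + a) n ∘ₗ (S.weightSpace k).subtype) ∘ₗ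
    (LinearEquiv.ofBijective (DirectSum.coeLinearMap S.weightSpace)
      (by exact S.weight_internal)).symm.toLinearMap

theorem zres_of_mem {k : ℤ} {u : V} (hu : u ∈ S.weightSpace k) (a : ℂ) (n : ℤ) (v : V) :
    S.zres a n u v = S.res ((k : ℂ) / 2 + a) n u v := by
  have : (LinearEquiv.ofBijective (DirectSum.coeLinearMap S.weightSpace)
      (by exact S.weight_internal)).symm u
      = DirectSum.lof ℂ ℤ (fun k => S.weightSpace k) k ⟨u, hu⟩ := by
    rw [LinearEquiv.symm_apply_eq]
    exact (DirectSum.coeLinearMap_lof S.weightSpace k ⟨u, hu⟩).symm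
  simp [zres, this]

theorem zres_zero_neg_one {k : ℤ} {u : V} (hu : u ∈ S.weightSpace k) (v : V) :
    S.zres 0 (-1) u v = S.zhuStar k u v := by
  rw [S.zres_of_mem hu, S.res_apply, add_zero, zhuStar]
  simp only [add_comm (-1 : ℤ), sub_eq_add_neg]

theorem zhuCirc_eq_res (k : ℤ) (u v : V) : S.zhuCirc k u v = S.res ((k : ℂ) / 2) (-2) u v := by
  rw [S.res_apply, zhuCirc]
  simp only [add_comm (-2 : ℤ), sub_eq_add_neg]

theorem zres_add_one (a : ℂ) (n : ℤ) (u v : V) :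
    S.zres (a + 1) n u v = S.zres a n u v + S.zres a (n + 1) u v := by
  induction u using S.weight_induction with
  | h0 => simp
  | hadd u u' h h' => simp only [map_add, LinearMap.add_apply, h, h']; abel
  | hC k u hu =>
    rw [S.zres_of_mem hu, S.zres_of_mem hu, S.zres_of_mem hu, ← add_assoc, S.res_add_one]

/-- Generators of O(V) need not be homogeneous in degree, but the signed identities require it;
compatibility of the gradings permits this reduction. -/
theorem zhuO_le {P : Submodule ℂ V} (h : ∀ k p q : ℤ, ∀ u ∈ S.weightSpace k, u ∈ S.deg p →
    ∀ v ∈ S.deg q, S.res ((k : ℂ) / 2) (-2) u v ∈ P) : S.zhuO ≤ P := by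
  rw [zhuO, Submodule.span_le]
  rintro _ ⟨k, u, hu, v, rfl⟩
  rw [SetLike.mem_coe, zhuCirc_eq_res]
  induction v using S.deg_induction with
  | h0 => simp
  | hadd v v' hv hv' => rw [map_add]; exact add_mem hv hv'
  | hC q v hv =>
    refine S.weight_deg_induction (C := fun u => S.res ((k : ℂ) / 2) (-2) u v ∈ P)
      (fun p u hu hp => h k p q u hu hp v hv) (by simp) (fun u u' h h' => ?_) hu
    rw [map_add]
    exact add_mem h h'

/-- Integration by parts: the case m for u_(-2) 1, whose weight is one larger, equals (m + 2) times
the case m + 1 for u minus a multiple of the case m for u. -/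
theorem res_mem_zhuO (m : ℕ) : ∀ {k : ℤ} {u : V}, u ∈ S.weightSpace k → ∀ v : V,
    S.res ((k : ℂ) / 2 + m) (-2 - m) u v ∈ S.zhuO := by
  induction m with
  | zero =>
    intro k u hu v
    refine Submodule.subset_span ⟨k, u, hu, v, ?_⟩
    simp [zhuCirc_eq_res]
  | succ m ih =>
    intro k u hu v
    have h1 := S.Y_mem_weightSpace hu S.vac_mem_weightSpace (-2)
    have h2 := ih h1 v
    have h3 := ih hu v
    rw [show ((k + 0 - 2 * -2 - 2 : ℤ) : ℂ) / 2 + m = ((k : ℂ) / 2 + m) + 1 by push_cast; ring,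
      S.res_translation] at h2
    have h4 := add_mem h2 (S.zhuO.smul_mem ((k : ℂ) / 2 + m + 1) h3)
    rw [sub_add_cancel] at h4
    rw [← S.zhuO.smul_mem_iff (s := -((-2 - m : ℤ) : ℂ))]
    · convert h4 using 3
      congr 1
      congr 1
      · push_cast; ring
      · push_cast; ring
    · have : ((2 + m : ℕ) : ℂ) ≠ 0 := by exact_mod_cast (by omega)
      push_cast at this ⊢
      rwa [neg_sub, sub_neg_eq_add, add_comm]

/-- Left multiplication `u ↦ b ∗ u` and the bracket `u ↦ [b, u]` preserve `O(V)`. -/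
theorem res_res_mem_zhuO {k l p q : ℤ} {b u : V} (hb : b ∈ S.weightSpace k) (hbp : b ∈ S.deg p)
    (hu : u ∈ S.weightSpace l) (huq : u ∈ S.deg q) (m : ℤ) (hm : m = -1 ∨ m = 0) (v : V) :
    S.res ((k : ℂ) / 2 - (m + 1)) m b (S.res ((l : ℂ) / 2) (-2) u v) ∈ S.zhuO := by
  rw [S.res_commutator hbp huq]
  refine add_mem (Submodule.negOnePow_smul_mem _ _ ?_)
    (Submodule.finsum_mem_of_forall _ fun t => Submodule.sum_mem _ fun r hr => ?_)
  · simpa using S.res_mem_zhuO 0 hu (S.res ((k : ℂ) / 2 - (m + 1)) m b v)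
  rw [mem_range] at hr
  have hw := S.Y_mem_weightSpace hb hu t
  rcases hm with rfl | rfl
  -- For m = -1 the power of x is -2 - (t - r + 1), and the exponent of 1 + x exceeds the weight of
  -- b_t u by t - r + 1.
  · refine Submodule.smul_mem _ _ ?_
    convert S.res_mem_zhuO (t - r + 1) hw v using 3
    congr 1
    · push_cast [show r ≤ t by omega]; ring
    · push_cast [show r ≤ t by omega]; ring
  -- For m = 0 the factor choose 0 (t - r) kills all terms but r = t, where the exponents are those
  -- of a generator of O(V).
  · by_cases hrt : r = t
    · subst hrt
      refine Submodule.smul_mem _ _ ?_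
      convert S.res_mem_zhuO 0 hw v using 3
      congr 1
      · push_cast; ring
      · push_cast; ring
    · rw [Int.cast_zero, Ring.choose_zero_pos ℂ (show 0 < t - r by omega)]
      simp

/-- The pair (0, -1) is the product ∗; the pair (-1, 0) is the residue that turns out to be its
supercommutator. -/
theorem zres_mem_zhuO_right {a : ℂ} {m : ℤ} (h : (a = 0 ∧ m = -1) ∨ (a = -1 ∧ m = 0)) (b : V)
    {o : V} (ho : o ∈ S.zhuO) : S.zres a m b o ∈ S.zhuO := by
  induction b using S.weight_induction with
  | h0 => simp
  | hadd b b' h h' => rw [map_add]; exact add_mem h h'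
  | hC k b hb =>
  refine S.weight_deg_induction (C := fun b => S.zres a m b o ∈ S.zhuO) ?_ (by simp)
    (fun b b' h h' => by rw [map_add]; exact add_mem h h') hb
  intro p b hb hbp
  refine S.zhuO_le (P := S.zhuO.comap (S.zres a m b)) (fun l q r u hu huq v hv => ?_) ho
  rw [Submodule.mem_comap, S.zres_of_mem hb]
  rcases h with ⟨rfl, rfl⟩ | ⟨rfl, rfl⟩
  · simpa using S.res_res_mem_zhuO hb hbp hu huq (-1) (Or.inl rfl) v
  · simpa [sub_eq_add_neg] using S.res_res_mem_zhuO hb hbp hu huq 0 (Or.inr rfl) v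

end DGVertexOperatorAlgebra

/-! ### Skew-symmetry and the supercommutator modulo O(V). -/

theorem Ring.sum_antidiagonal_neg_one_pow_choose (k l : ℂ) (s : ℕ) :
    ∑ x ∈ antidiagonal s, Ring.choose k x.1 * ((-1) ^ x.1 * ((-1) ^ x.2 *
      Ring.choose (s - (k + l)) x.2)) = Ring.choose (l - 1) s := by
  rw [Ring.choose_eq_neg_one_pow_mul_choose, show (s : ℂ) - 1 - (l - 1) = k + (s - (k + l)) by ring,
    Ring.add_choose_eq _ (Commute.all _ _), Finset.mul_sum]
  refine Finset.sum_congr rfl fun x hx => ?_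
  rw [HasAntidiagonal.mem_antidiagonal] at hx
  rw [← hx, pow_add]
  ring

namespace DGVertexOperatorAlgebra

variable {V : Type*} [AddCommGroup V] [Module ℂ V] (S : DGVertexOperatorAlgebra V)

theorem cls_eq_zero {v : V} : S.cls v = 0 ↔ v ∈ S.zhuO := Submodule.Quotient.mk_eq_zero _

theorem cls_Y_neg_two_vac {k : ℤ} {u : V} (hu : u ∈ S.weightSpace k) :
    S.cls (S.Y u (-2) S.vac) = (-((k : ℂ) / 2)) • S.cls u := by
  have h := S.cls_eq_zero.2 (S.res_mem_zhuO 0 hu S.vac)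
  rw [S.res_apply, finsum_eq_sum_range_of_forall_ge (N := 2)] at h
  · rw [Finset.sum_range_succ, Finset.sum_range_one] at h
    simp only [Nat.cast_zero, Nat.cast_one, Ring.choose_zero_right, Ring.choose_one_right,
        one_smul, sub_zero, add_zero] at h
    rw [show (-2 + 1 : ℤ) = -1 by norm_num, (S.creation u).1, map_add, map_smul] at h
    rw [eq_neg_of_add_eq_zero_left h, neg_smul]
  · intro i hi
    rw [(S.creation u).2 _ (by simp only [Nat.cast_zero]; omega), smul_zero]

/-- Since u∘1 = L(-1)u + (wt u)u, the operator L(-1) acts as -L(0) modulo O(V) and raises weight by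
one; iterating, e^(xL(-1)) becomes (1+x)^(-L(0)). -/
theorem cls_Y_vac (i : ℕ) : ∀ {k : ℤ} {u : V}, u ∈ S.weightSpace k →
    S.cls (S.Y u (-1 - i) S.vac) = Ring.choose (-((k : ℂ) / 2)) i • S.cls u := by
  induction i with
  | zero =>
    intro k u _
    simp [(S.creation u).1]
  | succ i ih =>
    intro k u hu
    have h1 := ih (S.Y_mem_weightSpace hu S.vac_mem_weightSpace (-2))
    rw [S.translation, S.cls_Y_neg_two_vac hu, ← Int.cast_smul_eq_zsmul ℂ, map_smul] at h1
    have h2 := Ring.succ_mul_choose_succ (-((k : ℂ) / 2)) i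
    have h3 : ((i : ℂ) + 1) ≠ 0 := by exact_mod_cast Nat.succ_ne_zero i
    refine smul_right_injective _ h3 ?_
    simp only
    rw [smul_smul, h2]
    convert h1 using 1
    · congr 1
      · push_cast; ring
      · congr 3; push_cast; ring_nf
    · rw [smul_smul, mul_comm]
      congr 3
      push_cast; ring

theorem cls_Y_eq_sum {k l p q : ℤ} {u v : V} (hu : u ∈ S.weightSpace k) (hup : u ∈ S.deg p)
    (hv : v ∈ S.weightSpace l) (hvq : v ∈ S.deg q) {N : ℕ} {j : ℕ}
    (hN : ∀ i, N ≤ i → S.Y v (-1 + i) u = 0) :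
    S.cls (S.Y u (-1 + j) v) = (p * q).negOnePow • ∑ i ∈ range N,
      ((-1) ^ j * ((-1) ^ i * Ring.choose (((j + i : ℕ) : ℂ) - ((k : ℂ) / 2 + (l : ℂ) / 2)) i)) •
        S.cls (S.Y v (-1 + (j + i : ℕ)) u) := by
  rw [S.skew_symmetry hvq hup, show q * p + (-1 + j) + 1 = p * q + j by ring, Int.negOnePow_add,
    ← smul_smul, finsum_eq_sum_range_of_forall_ge (N := N), LinearMap.map_negOnePow_smul,
    LinearMap.map_negOnePow_smul, map_sum, ← Int.cast_negOnePow_smul j,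
    Int.coe_negOnePow_natCast, Finset.smul_sum]
  · congr 1
    refine Finset.sum_congr rfl fun i _ => ?_
    have h := S.cls_Y_vac i (S.Y_mem_weightSpace hv hu (-1 + j + i))
    rw [← Int.cast_smul_eq_zsmul ℂ, map_smul, h, smul_smul, smul_smul,
      show (-1 : ℤ) + ((j + i : ℕ) : ℤ) = -1 + j + i by push_cast; ring]
    congr 1
    push_cast
    rw [mul_assoc]
    congr 3
    ring
  · intro i hi
    rw [add_assoc, ← Nat.cast_add, hN _ (by omega)]
    simp

/-- Skew-symmetry with e^(xL(-1)) replaced by (1+x)^(-L(0)) amounts to the substitution x ↦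
-x/(1+x). Here it is done on coefficients: those of v_(-1+s) u add up to choose (wt v - 1) s. -/
theorem cls_zres_skew {p q : ℤ} {u v : V} (hu : u ∈ S.deg p) (hv : v ∈ S.deg q) :
    S.cls (S.zres 0 (-1) u v) = (p * q).negOnePow • S.cls (S.zres (-1) (-1) v u) := by
  refine S.deg_weight_induction (C := fun u =>
    S.cls (S.zres 0 (-1) u v) = (p * q).negOnePow • S.cls (S.zres (-1) (-1) v u))
    ?_ (by simp) (fun u u' h h' => by simp [h, h']) hu
  intro k u hu hup
  refine S.deg_weight_induction (C := fun v =>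
    S.cls (S.zres 0 (-1) u v) = (p * q).negOnePow • S.cls (S.zres (-1) (-1) v u))
    ?_ (by simp) (fun u u' h h' => by simp [h, h']) hv
  intro l v hv hvq
  rw [S.zres_of_mem hu, S.zres_of_mem hv, add_zero]
  obtain ⟨N, h1, h2, h3⟩ := ((S.eventually_Y_eq_zero v u (-1)).and
    ((S.eventually_res ((k : ℂ) / 2) (-1) u v).and
      (S.eventually_res ((l : ℂ) / 2 + -1) (-1) v u))).exists
  rw [h2, h3, map_sum, map_sum]
  have h4 : ∀ j : ℕ, S.cls (Ring.choose ((k : ℂ) / 2) j • S.Y u (-1 + j) v)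
      = (p * q).negOnePow • ∑ i ∈ range N, (Ring.choose ((k : ℂ) / 2) j * ((-1) ^ j * ((-1) ^ i *
        Ring.choose (((j + i : ℕ) : ℂ) - ((k : ℂ) / 2 + (l : ℂ) / 2)) i))) •
        S.cls (S.Y v (-1 + (j + i : ℕ)) u) := by
    intro j
    rw [map_smul, S.cls_Y_eq_sum hu hup hv hvq h1, smul_comm, Finset.smul_sum]
    simp only [smul_smul]
  simp only [h4]
  rw [← Finset.smul_sum]
  congr 1
  rw [Finset.sum_range_product_eq_sum_antidiagonal (f := fun j i =>
    (Ring.choose ((k : ℂ) / 2) j * ((-1) ^ j * ((-1) ^ i *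
        Ring.choose (((j + i : ℕ) : ℂ) - ((k : ℂ) / 2 + (l : ℂ) / 2)) i))) •
        S.cls (S.Y v (-1 + (j + i : ℕ)) u))
    (fun i j hij => by rw [h1 _ hij, map_zero, smul_zero])]
  refine Finset.sum_congr rfl fun s _ => ?_
  rw [map_smul, ← sub_eq_add_neg, ← Ring.sum_antidiagonal_neg_one_pow_choose ((k : ℂ) / 2),
    Finset.sum_smul]
  refine Finset.sum_congr rfl fun x hx => ?_
  rw [HasAntidiagonal.mem_antidiagonal] at hx
  rw [hx]

/-- The supercommutator for `∗`, modulo `O(V)`. -/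
theorem cls_zres_commutator {p q : ℤ} {u v : V} (hu : u ∈ S.deg p) (hv : v ∈ S.deg q) :
    S.cls (S.zres (-1) 0 u v)
      = S.cls (S.zres 0 (-1) u v) - (p * q).negOnePow • S.cls (S.zres 0 (-1) v u) := by
  have h := S.zres_add_one (-1) (-1) u v
  rw [neg_add_cancel, neg_add_cancel] at h
  rw [S.cls_zres_skew hv hu, mul_comm q p, Int.negOnePow_smul_self, h, map_add,
    add_sub_cancel_left]

theorem cls_zres_skew_bracket {p q : ℤ} {u v : V} (hu : u ∈ S.deg p) (hv : v ∈ S.deg q) :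
    S.cls (S.zres (-1) 0 u v) = -((p * q).negOnePow • S.cls (S.zres (-1) 0 v u)) := by
  rw [S.cls_zres_commutator hu hv, S.cls_zres_commutator hv hu, smul_sub, mul_comm q p,
    Int.negOnePow_smul_self, neg_sub]

end DGVertexOperatorAlgebra

/-! ### Descent to A(V). -/

theorem LinearMap.exists_lift_of_surjective {V W G : Type*} [AddCommGroup V] [Module ℂ V]
    [AddCommGroup W] [Module ℂ W] [AddCommGroup G] [Module ℂ G] (f : V →ₗ[ℂ] G)
    (hf : Function.Surjective f) (B : V →ₗ[ℂ] W) (h : ∀ u, f u = 0 → B u = 0) :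
    ∃ B' : G →ₗ[ℂ] W, ∀ u, B' (f u) = B u := by
  obtain ⟨g, hg⟩ := f.exists_rightInverse_of_surjective (LinearMap.range_eq_top.2 hf)
  have hg' : ∀ x, f (g x) = x := fun x => LinearMap.congr_fun hg x
  refine ⟨B ∘ₗ g, fun u => ?_⟩
  rw [LinearMap.comp_apply, ← sub_eq_zero, ← map_sub]
  exact h _ (by rw [map_sub, hg', sub_self])

theorem LinearMap.exists_lift₂_of_surjective {V W G : Type*} [AddCommGroup V] [Module ℂ V]
    [AddCommGroup W] [Module ℂ W] [AddCommGroup G] [Module ℂ G] (f : V →ₗ[ℂ] G)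
    (hf : Function.Surjective f) (B : V →ₗ[ℂ] V →ₗ[ℂ] W)
    (hl : ∀ u v, f u = 0 → B u v = 0) (hr : ∀ u v, f v = 0 → B u v = 0) :
    ∃ B' : G →ₗ[ℂ] G →ₗ[ℂ] W, ∀ u v, B' (f u) (f v) = B u v := by
  obtain ⟨g, hg⟩ := f.exists_rightInverse_of_surjective (LinearMap.range_eq_top.2 hf)
  have hg' : ∀ x, f (g x) = x := fun x => LinearMap.congr_fun hg x
  refine ⟨B.compl₁₂ g g, fun u v => ?_⟩
  rw [LinearMap.compl₁₂_apply]
  have h1 : B (g (f u)) (g (f v)) = B u (g (f v)) := by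
    rw [← sub_eq_zero, ← LinearMap.sub_apply, ← map_sub]
    exact hl _ _ (by rw [map_sub, hg', sub_self])
  rw [h1, ← sub_eq_zero, ← map_sub]
  exact hr _ _ (by rw [map_sub, hg', sub_self])

namespace DGVertexOperatorAlgebra

variable {V : Type*} [AddCommGroup V] [Module ℂ V] (S : DGVertexOperatorAlgebra V)

theorem cls_surjective : Function.Surjective S.cls := Submodule.mkQ_surjective _

/-- The commutator formulas for iterates `a_(j) b`, whose parity is that of `|a| + |b|`. -/
theorem cls_zres_res_commutator {p q r : ℤ} {a b v : V} (ha : a ∈ S.deg p) (hb : b ∈ S.deg q)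
    (hv : v ∈ S.deg r) (c : ℂ) (n : ℤ) :
    S.cls (S.zres (-1) 0 (S.res c n a b) v) = S.cls (S.zres 0 (-1) (S.res c n a b) v)
        - ((p + q) * r).negOnePow • S.cls (S.zres 0 (-1) v (S.res c n a b)) ∧
    S.cls (S.zres (-1) 0 (S.res c n a b) v)
      = -(((p + q) * r).negOnePow • S.cls (S.zres (-1) 0 v (S.res c n a b))) := by
  obtain ⟨N, h⟩ := (S.eventually_res c n a b).exists
  have hs : ∀ i : ℕ, ((p + q - 2 * (n + i) - 2) * r).negOnePow = ((p + q) * r).negOnePow := by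
    intro i
    rw [show (p + q - 2 * (n + i) - 2) * r = (p + q) * r + 2 * (-(n + i) * r - r) by ring,
      Int.negOnePow_add, Int.negOnePow_two_mul, mul_one]
  have h1 := fun i : ℕ => S.cls_zres_commutator (S.Y_mem p q (n + i) a ha b hb) hv
  have h2 := fun i : ℕ => S.cls_zres_skew_bracket (S.Y_mem p q (n + i) a ha b hb) hv
  simp only [hs] at h1 h2
  rw [h]
  simp only [map_sum, map_smul, LinearMap.sum_apply, LinearMap.smul_apply]
  constructor
  · rw [Finset.smul_sum, ← Finset.sum_sub_distrib]
    refine Finset.sum_congr rfl fun i _ => ?_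
    rw [h1 i, smul_sub, smul_comm]
  · rw [Finset.smul_sum, ← Finset.sum_neg_distrib]
    refine Finset.sum_congr rfl fun i _ => ?_
    rw [h2 i, smul_neg, smul_comm]

/-- Modulo O(V) the bracket of o with v is, up to sign, that of v with o, which vanishes; then o∗v
agrees up to sign with v∗o, which vanishes too. -/
theorem zres_mem_zhuO_left {a : ℂ} {m : ℤ} (h : (a = 0 ∧ m = -1) ∨ (a = -1 ∧ m = 0)) (v : V)
    {o : V} (ho : o ∈ S.zhuO) : S.zres a m o v ∈ S.zhuO := by
  induction v using S.deg_induction with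
  | h0 => simp
  | hadd v v' h h' => rw [map_add]; exact add_mem h h'
  | hC r v hv =>
  refine S.zhuO_le (P := S.zhuO.comap ((S.zres a m).flip v)) (fun k p q x hx hxp y hy => ?_) ho
  rw [Submodule.mem_comap, LinearMap.flip_apply, ← S.cls_eq_zero]
  obtain ⟨h1, h2⟩ := S.cls_zres_res_commutator hxp hy hv ((k : ℂ) / 2) (-2)
  have hO : S.res ((k : ℂ) / 2) (-2) x y ∈ S.zhuO := by simpa using S.res_mem_zhuO 0 hx y
  rw [S.cls_eq_zero.2 (S.zres_mem_zhuO_right (Or.inr ⟨rfl, rfl⟩) v hO), smul_zero, neg_zero] at h2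
  rcases h with ⟨rfl, rfl⟩ | ⟨rfl, rfl⟩
  · rwa [h2, S.cls_eq_zero.2 (S.zres_mem_zhuO_right (Or.inl ⟨rfl, rfl⟩) v hO), smul_zero, sub_zero,
      eq_comm] at h1
  · exact h2

/-- As dω = 0 and ω_1 has degree 0, d commutes with L(0). -/
theorem d_mem_weightSpace {k : ℤ} {u : V} (hu : u ∈ S.weightSpace k) :
    S.d u ∈ S.weightSpace k := by
  rw [mem_weightSpace] at hu ⊢
  have h := S.d_Y 4 1 S.omega S.omega_mem u
  rw [S.d_omega, hu, map_smul, show (4 : ℤ) - 2 * 1 - 2 = 0 by norm_num, Int.negOnePow_zero,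
    one_smul] at h
  rw [h]
  simp

theorem d_mem_zhuO {o : V} (ho : o ∈ S.zhuO) : S.d o ∈ S.zhuO := by
  refine S.zhuO_le (P := S.zhuO.comap S.d) (fun k p q x hx hxp y hy => ?_) ho
  rw [Submodule.mem_comap, S.d_res hxp]
  refine add_mem ?_ (Submodule.negOnePow_smul_mem _ _ ?_)
  · simpa using S.res_mem_zhuO 0 (S.d_mem_weightSpace hx) y
  · simpa using S.res_mem_zhuO 0 hx (S.d y)

theorem zres_sub_mem_fil {p q r : ℤ} {u v : V} (hu : u ∈ S.deg p) (hv : v ∈ S.deg q) (a : ℂ)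
    (n : ℤ) (hr : p + q - 2 * n - 4 ≤ r) : S.zres a n u v - S.Y u n v ∈ S.fil r := by
  refine S.deg_weight_induction (C := fun u => S.zres a n u v - S.Y u n v ∈ S.fil r) ?_ (by simp)
    (fun u u' h h' => ?_) hu
  · intro k u hk hu
    rw [S.zres_of_mem hk]
    exact S.res_sub_mem_fil hu hv _ n hr
  · have := add_mem h h'
    rw [← add_sub_add_comm] at this
    simpa only [map_add, LinearMap.add_apply, Pi.add_apply] using this

theorem zres_mem_fil {p q r : ℤ} {u v : V} (hu : u ∈ S.fil p) (hv : v ∈ S.fil q) (a : ℂ)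
    (n : ℤ) (hr : p + q - 2 * n - 2 ≤ r) : S.zres a n u v ∈ S.fil r := by
  refine S.fil_induction (C := fun u => S.zres a n u v ∈ S.fil r) (fun p' hp' u hu => ?_) (by simp)
    (fun u u' h h' => by rw [map_add]; exact add_mem h h') hu
  refine S.fil_induction (C := fun v => S.zres a n u v ∈ S.fil r) (fun q' hq' v hv => ?_) (by simp)
    (fun u u' h h' => by rw [map_add]; exact add_mem h h') hv
  rw [← sub_add_cancel (S.zres a n u v) (S.Y u n v)]
  exact add_mem (S.zres_sub_mem_fil hu hv a n (by omega))
    (S.mem_fil (by omega) (S.Y_mem p' q' n u hu v hv))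

/-! ### The associated graded space as a quotient of V. -/

theorem cls_mem_zhuF {p : ℤ} {v : V} (hv : v ∈ S.fil p) : S.cls v ∈ S.zhuF p :=
  Submodule.mem_map_of_mem hv

theorem zhuF_mono {p q : ℤ} (h : p ≤ q) : S.zhuF p ≤ S.zhuF q :=
  Submodule.map_mono (S.fil_mono h)

theorem exists_mem_fil {p : ℤ} {x : S.Zhu} (hx : x ∈ S.zhuF p) : ∃ v ∈ S.fil p, S.cls v = x := hx

theorem symb_eq_symb {p : ℤ} {x y : S.zhuF p} :
    S.symb p x = S.symb p y ↔ (x : S.Zhu) - y ∈ S.zhuF (p - 1) := by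
  rw [symb, LinearMap.comp_apply, LinearMap.comp_apply, DirectSum.lof_eq_of,
    DirectSum.lof_eq_of, (DirectSum.of_injective (β := S.grZhu) p).eq_iff,
    Submodule.mkQ_apply, Submodule.mkQ_apply, Submodule.Quotient.eq]
  rfl

/-- The map `V → gr A(V)` taking `v ∈ V^[p]` to its class in `gr^[p] A(V)`. -/
noncomputable def grMap : V →ₗ[ℂ] (⨁ p, S.grZhu p) :=
  DirectSum.toModule ℂ ℤ _ (fun p => S.symb p ∘ₗ
    S.cls.restrict (p := S.deg p) (q := S.zhuF p) (fun _ hv => S.cls_mem hv)) ∘ₗ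
    S.degEquiv.symm.toLinearMap

theorem grMap_of_mem {p : ℤ} {v : V} (hv : v ∈ S.deg p) :
    S.grMap v = S.symbCls p ⟨v, hv⟩ := by
  simp [grMap, S.degEquiv_symm_of_mem hv, symbCls]
  rfl

theorem grMap_eq_zero {p : ℤ} {v : V} (hv : v ∈ S.deg p) :
    S.grMap v = 0 ↔ S.cls v ∈ S.zhuF (p - 1) := by
  rw [S.grMap_of_mem hv, symbCls, ← map_zero (S.symb p), S.symb_eq_symb]
  simp

theorem grMap_mem_range {p : ℤ} {v : V} (hv : v ∈ S.deg p) :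
    S.grMap v ∈ LinearMap.range (DirectSum.lof ℂ ℤ S.grZhu p) := by
  rw [S.grMap_of_mem hv]
  exact ⟨_, rfl⟩

theorem exists_symbCls_eq (p : ℤ) (x : S.zhuF p) : ∃ u : S.deg p, S.symbCls p u = S.symb p x := by
  obtain ⟨v, hv, hx⟩ := S.exists_mem_fil x.2
  obtain ⟨u, hu, h⟩ := S.exists_deg_add_fil hv
  refine ⟨⟨u, hu⟩, ?_⟩
  rw [symbCls, symb_eq_symb, ← neg_mem_iff, neg_sub, ← hx, ← map_sub]
  exact S.cls_mem_zhuF h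

theorem exists_grMap_eq_lof (p : ℤ) (x : S.grZhu p) :
    ∃ u ∈ S.deg p, DirectSum.lof ℂ ℤ S.grZhu p x = S.grMap u := by
  obtain ⟨y, rfl⟩ := Submodule.mkQ_surjective _ x
  obtain ⟨u, hu⟩ := S.exists_symbCls_eq p y
  exact ⟨u, u.2, by rw [S.grMap_of_mem u.2, hu]; rfl⟩

theorem grMap_surjective : Function.Surjective S.grMap := by
  intro x
  induction x using DirectSum.induction_on with
  | zero => exact ⟨0, map_zero _⟩
  | of p x =>
    obtain ⟨u, -, hu⟩ := S.exists_grMap_eq_lof p x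
    exact ⟨u, hu.symm⟩
  | add x y hx hy =>
    obtain ⟨u, rfl⟩ := hx
    obtain ⟨v, rfl⟩ := hy
    exact ⟨u + v, map_add _ _ _⟩

/-- Makes the kernel of `grMap` a graded subspace, so that stability of the kernel can be tested on
homogeneous vectors. -/
theorem grMap_degProj (p : ℤ) (v : V) :
    S.grMap (S.degProj p v) = DirectSum.lof ℂ ℤ S.grZhu p
      (DirectSum.component ℂ ℤ S.grZhu p (S.grMap v)) := by
  induction v using S.deg_induction with
  | h0 => simp
  | hadd u v hu hv => simp only [map_add, hu, hv]
  | hC q v hv =>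
    obtain ⟨x, hx⟩ := S.grMap_mem_range hv
    by_cases h : q = p
    · subst h
      rw [S.degProj_of_mem hv, ← hx, DirectSum.component.lof_self]
    · rw [S.degProj_of_mem_ne hv h, ← hx, DirectSum.component.of, dif_neg h, map_zero, map_zero]

theorem grMap_degProj_eq_zero {v : V} (hv : S.grMap v = 0) (p : ℤ) :
    S.grMap (S.degProj p v) = 0 := by
  rw [S.grMap_degProj, hv, map_zero, map_zero]

theorem grMap_zres_eq {p q : ℤ} {u v : V} (hu : u ∈ S.deg p) (hv : v ∈ S.deg q) (a : ℂ) (n : ℤ)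
    (h : S.cls (S.zres a n u v) ∈ S.zhuF (p + q - 2 * n - 2 - 1)) : S.grMap (S.Y u n v) = 0 := by
  rw [S.grMap_eq_zero (S.Y_mem p q n u hu v hv),
    ← sub_sub_cancel (S.zres a n u v) (S.Y u n v), map_sub]
  exact sub_mem h (S.cls_mem_zhuF (S.zres_sub_mem_fil hu hv a n (by omega)))

/-- Both arguments are replaced by representatives of low degree; the errors vanish because O(V) is
stable on both sides. -/
theorem cls_zres_mem_zhuF {a : ℂ} {n : ℤ} (h : (a = 0 ∧ n = -1) ∨ (a = -1 ∧ n = 0)) {p q r : ℤ}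
    {u v : V} (hu : S.cls u ∈ S.zhuF p) (hv : S.cls v ∈ S.zhuF q) (hr : p + q - 2 * n - 2 ≤ r) :
    S.cls (S.zres a n u v) ∈ S.zhuF r := by
  obtain ⟨u', hu', hu⟩ := S.exists_mem_fil hu
  obtain ⟨v', hv', hv⟩ := S.exists_mem_fil hv
  have h1 : S.cls (S.zres a n u v) = S.cls (S.zres a n u' v) := by
    rw [← sub_eq_zero, ← map_sub, ← LinearMap.sub_apply, ← map_sub, S.cls_eq_zero]
    exact S.zres_mem_zhuO_left h _ (S.cls_eq_zero.1 (by rw [map_sub, hu, sub_self]))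
  have h2 : S.cls (S.zres a n u' v) = S.cls (S.zres a n u' v') := by
    rw [← sub_eq_zero, ← map_sub, ← map_sub, S.cls_eq_zero]
    exact S.zres_mem_zhuO_right h _ (S.cls_eq_zero.1 (by rw [map_sub, hv, sub_self]))
  rw [h1, h2]
  exact S.cls_mem_zhuF (S.zres_mem_fil hu' hv' a n hr)

theorem grMap_Y_eq_zero {n : ℤ} (hn : n = -1 ∨ n = 0) {u v : V}
    (h : S.grMap u = 0 ∨ S.grMap v = 0) : S.grMap (S.Y u n v) = 0 := by
  obtain ⟨a, ha⟩ : ∃ a : ℂ, (a = 0 ∧ n = -1) ∨ (a = -1 ∧ n = 0) := by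
    rcases hn with rfl | rfl
    · exact ⟨0, Or.inl ⟨rfl, rfl⟩⟩
    · exact ⟨-1, Or.inr ⟨rfl, rfl⟩⟩
  refine S.degProj_induction (C := fun u => S.grMap (S.Y u n v) = 0) (by simp)
    (fun u u' h h' => by simp [h, h']) u fun p => ?_
  refine S.degProj_induction (C := fun v => S.grMap (S.Y (S.degProj p u) n v) = 0) (by simp)
    (fun u u' h h' => by simp [h, h']) v fun q => ?_
  have hu := S.degProj_mem p u
  have hv := S.degProj_mem q v
  refine S.grMap_zres_eq hu hv a n ?_
  rcases h with h | h
  · exact S.cls_zres_mem_zhuF ha ((S.grMap_eq_zero hu).1 (S.grMap_degProj_eq_zero h p))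
      (S.cls_mem hv) (by omega)
  · exact S.cls_zres_mem_zhuF ha (S.cls_mem hu)
      ((S.grMap_eq_zero hv).1 (S.grMap_degProj_eq_zero h q)) (by omega)

theorem grMap_d_eq_zero {u : V} (h : S.grMap u = 0) : S.grMap (S.d u) = 0 := by
  refine S.degProj_induction (C := fun u => S.grMap (S.d u) = 0) (by simp)
    (fun u u' h h' => by simp [h, h']) u fun p => ?_
  have hu := S.degProj_mem p u
  rw [S.grMap_eq_zero (S.d_mem p _ hu)]
  obtain ⟨w, hw, hc⟩ := S.exists_mem_fil ((S.grMap_eq_zero hu).1 (S.grMap_degProj_eq_zero h p))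
  have h1 : S.cls (S.d (S.degProj p u)) = S.cls (S.d w) := by
    rw [← sub_eq_zero, ← map_sub, ← map_sub, S.cls_eq_zero]
    exact S.d_mem_zhuO (S.cls_eq_zero.1 (by rw [map_sub, hc, sub_self]))
  rw [h1]
  refine S.cls_mem_zhuF (S.fil_induction (C := fun w => S.d w ∈ S.fil (p + 1 - 1))
    (fun q hq w hw => S.mem_fil (by omega) (S.d_mem q w hw)) (by simp)
    (fun w w' h h' => by rw [map_add]; exact add_mem h h') hw)

/-- The image of `C₂(V)` in `gr A(V)` vanishes. -/
theorem grMap_Y_neg_two_sub (m : ℕ) (u v : V) : S.grMap (S.Y u (-2 - m) v) = 0 := by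
  induction u using S.deg_induction with
  | h0 => simp
  | hadd u u' h h' => simp [h, h']
  | hC p u hu =>
  induction v using S.deg_induction with
  | h0 => simp
  | hadd u u' h h' => simp [h, h']
  | hC q v hv =>
  refine S.deg_weight_induction (C := fun u => S.grMap (S.Y u (-2 - m) v) = 0) ?_ (by simp)
    (fun u u' h h' => by simp [h, h']) hu
  intro k u hk hu
  -- The exponent of 1 + x does not affect the leading term; the shift m is the one that puts the
  -- residue in O(V).
  refine S.grMap_zres_eq hu hv m _ ?_
  rw [S.zres_of_mem hk, S.cls_eq_zero.2 (S.res_mem_zhuO m hk v)]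
  exact zero_mem _

end DGVertexOperatorAlgebra

theorem LinearMap.map_finsum_eq_single {V W : Type*} [AddCommMonoid V] [Module ℂ V]
    [AddCommMonoid W] [Module ℂ W] (f : V →ₗ[ℂ] W) {g : ℕ → V} (hg : g.support.Finite)
    (h : ∀ i, i ≠ 0 → f (g i) = 0) : f (∑ᶠ i, g i) = f (g 0) := by
  have := f.toAddMonoidHom.map_finsum hg
  simp only [LinearMap.toAddMonoidHom_coe] at this
  rw [this]
  exact finsum_eq_single _ 0 h

/-! ### The dg Poisson algebra of a quotient killing C₂(V). -/

namespace DGVertexAlgebra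

variable {V : Type*} [AddCommGroup V] [Module ℂ V] (S : DGVertexAlgebra V)

/-- Only the i = 0 term of skew-symmetry avoids C₂(V). The case n = -1 is graded commutativity, n =
0 skewness of the bracket. -/
theorem map_skew {W : Type*} [AddCommGroup W] [Module ℂ W] (π : V →ₗ[ℂ] W)
    (hπ : ∀ (m : ℕ) u v, π (S.Y u (-2 - m) v) = 0) {p q : ℤ} {u v : V} (hu : u ∈ S.deg p)
    (hv : v ∈ S.deg q) (n : ℤ) :
    π (S.Y u n v) = (p * q + n + 1).negOnePow • π (S.Y v n u) := by
  obtain ⟨N, h⟩ := (S.eventually_Y_eq_zero v u n).exists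
  rw [S.skew_symmetry hv hu, mul_comm, LinearMap.map_negOnePow_smul, LinearMap.map_finsum_eq_single]
  · simp [(S.creation _).1]
  · refine (Set.finite_lt_nat N).subset fun i hi => ?_
    by_contra hc
    exact hi (by simp [h i (not_lt.1 hc)])
  · intro i hi
    obtain ⟨j, rfl⟩ := Nat.exists_eq_succ_of_ne_zero hi
    rw [map_zsmul, show (-1 - (j.succ : ℤ)) = -2 - j by push_cast; ring, hπ,
      smul_zero]

/-- In the iterate formula every term but u_(-1) v_(-1) w has outermost mode at most -2. -/
theorem map_assoc {W : Type*} [AddCommGroup W] [Module ℂ W] (π : V →ₗ[ℂ] W)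
    (hπ : ∀ (m : ℕ) u v, π (S.Y u (-2 - m) v) = 0) (u v w : V) :
    π (S.Y (S.Y u (-1) v) (-1) w) = π (S.Y u (-1) (S.Y v (-1) w)) := by
  induction u using S.deg_induction with
  | h0 => simp
  | hadd u u' h h' => simp [h, h']
  | hC p u hu =>
  induction v using S.deg_induction with
  | h0 => simp
  | hadd u u' h h' => simp [h, h']
  | hC q v hv =>
  obtain ⟨N, h, h'⟩ := ((S.eventually_Y_eq_zero v w (-1)).and
    (S.eventually_Y_eq_zero u w 0)).exists
  rw [S.Y_Y_neg_one hu hv, LinearMap.map_finsum_eq_single]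
  · have := hπ 0 v (S.Y u 0 w)
    simp only [Nat.cast_zero, sub_zero] at this
    simp [this]
  · refine (Set.finite_lt_nat N).subset fun i hi => ?_
    by_contra hc
    have h'' := h' i (not_lt.1 hc)
    rw [zero_add] at h''
    exact hi (by simp [h i (not_lt.1 hc), h''])
  · intro i hi
    obtain ⟨j, rfl⟩ := Nat.exists_eq_succ_of_ne_zero hi
    rw [map_add, LinearMap.map_negOnePow_smul, hπ,
      show (-1 - (j.succ : ℤ)) = -2 - j by push_cast; ring, hπ, smul_zero,
      add_zero]

/-- u_0 is a superderivation of every mode product: n = 0 yields the Poisson Jacobi identity, n = -1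
the Leibniz rule. -/
theorem Y_zero_Y {p q : ℤ} {u v : V} (hu : u ∈ S.deg p) (hv : v ∈ S.deg q) (n : ℤ) (w : V) :
    S.Y u 0 (S.Y v n w) = S.Y (S.Y u 0 v) n w + (p * q).negOnePow • S.Y v n (S.Y u 0 w) := by
  rw [S.commutator hu hv, add_comm, finsum_eq_single _ 0]
  · simp
  · intro i hi
    rw [Ring.choose_zero_pos ℤ (Nat.pos_of_ne_zero hi), zero_smul]

/-- A graded quotient of `V` on which `C₂(V)` vanishes, by a subspace stable under the products
`u_(-1) v` and `u_0 v` and under the differential, is a dg Poisson algebra. -/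
theorem exists_dgPoissonAlgebra {G : ℤ → Type*} [∀ p, AddCommGroup (G p)] [∀ p, Module ℂ (G p)]
    (π : V →ₗ[ℂ] ⨁ p, G p) (hπ : ∀ (m : ℕ) u v, π (S.Y u (-2 - m) v) = 0)
    (hsurj : Function.Surjective π)
    (hdeg : ∀ p, ∀ u ∈ S.deg p, ∃ x : G p, DirectSum.lof ℂ ℤ G p x = π u)
    (hlof : ∀ p (x : G p), ∃ u ∈ S.deg p, DirectSum.lof ℂ ℤ G p x = π u)
    (hker : ∀ {n : ℤ}, n = -1 ∨ n = 0 → ∀ {u v : V}, π u = 0 ∨ π v = 0 → π (S.Y u n v) = 0)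
    (hkerd : ∀ u, π u = 0 → π (S.d u) = 0) : ∃ P : DGPoissonAlgebra G (-2),
    P.one = π S.vac ∧
    (∀ u v, P.mul (π u) (π v) = π (S.Y u (-1) v)) ∧
    (∀ u v, P.bracket (π u) (π v) = π (S.Y u 0 v)) ∧
    (∀ u, P.d (π u) = π (S.d u)) := by
  obtain ⟨mul, hmul⟩ := LinearMap.exists_lift₂_of_surjective π hsurj
    ((S.mode (-1)).compr₂ π) (fun u v h => hker (Or.inl rfl) (Or.inl h))
    (fun u v h => hker (Or.inl rfl) (Or.inr h))
  obtain ⟨br, hbr⟩ := LinearMap.exists_lift₂_of_surjective π hsurj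
    ((S.mode 0).compr₂ π) (fun u v h => hker (Or.inr rfl) (Or.inl h))
    (fun u v h => hker (Or.inr rfl) (Or.inr h))
  obtain ⟨d, hd⟩ := LinearMap.exists_lift_of_surjective π hsurj
    (π ∘ₗ S.d) (fun u h => hkerd u h)
  simp only [LinearMap.compr₂_apply, DGVertexAlgebra.mode_apply, LinearMap.comp_apply]
    at hmul hbr hd
  -- The bracket has even degree, so its degree shift changes no Koszul sign.
  have sgn : ∀ p q : ℤ, ((p + -2) * (q + -2)).negOnePow = (p * q).negOnePow := fun p q => by
    rw [show (p + -2) * (q + -2) = p * q + 2 * (2 - p - q) by ring, Int.negOnePow_add,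
      Int.negOnePow_two_mul, mul_one]
  have sgn' : ∀ p q : ℤ, ((p + -2) * q).negOnePow = (p * q).negOnePow := fun p q => by
    rw [show (p + -2) * q = p * q + 2 * (-q) by ring, Int.negOnePow_add,
      Int.negOnePow_two_mul, mul_one]
  have sgn2 : (-2 : ℤ).negOnePow = 1 := Int.negOnePow_even _ ⟨-1, rfl⟩
  refine ⟨{ one := π S.vac, mul := mul, bracket := br, d := d
            one_mem := hdeg 0 _ S.vac_mem
            mul_mem := ?_, bracket_mem := ?_, d_mem := ?_, one_mul := ?_, mul_one := ?_
            mul_assoc := ?_, mul_comm := ?_, d_d := ?_, d_mul := ?_, bracket_skew := ?_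
            bracket_jacobi := ?_, bracket_mul := ?_, d_bracket := ?_ }, rfl, hmul, hbr, hd⟩
  · intro p q x y
    obtain ⟨u, hu, hx⟩ := hlof p x
    obtain ⟨v, hv, hy⟩ := hlof q y
    rw [hx, hy, hmul]
    refine hdeg _ _ ?_
    simpa using S.Y_mem p q (-1) u hu v hv
  · intro p q x y
    obtain ⟨u, hu, hx⟩ := hlof p x
    obtain ⟨v, hv, hy⟩ := hlof q y
    rw [hx, hy, hbr]
    refine hdeg _ _ ?_
    simpa [sub_eq_add_neg] using S.Y_mem p q 0 u hu v hv
  · intro p x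
    obtain ⟨u, hu, hx⟩ := hlof p x
    rw [hx, hd]
    exact hdeg _ _ (S.d_mem p u hu)
  · intro a
    obtain ⟨u, rfl⟩ := hsurj a
    rw [hmul, S.vacuum, if_pos rfl]
  · intro a
    obtain ⟨u, rfl⟩ := hsurj a
    rw [hmul, (S.creation u).1]
  · intro a b c
    obtain ⟨u, rfl⟩ := hsurj a
    obtain ⟨v, rfl⟩ := hsurj b
    obtain ⟨w, rfl⟩ := hsurj c
    rw [hmul, hmul, hmul, hmul, S.map_assoc π hπ]
  · intro p q x y
    obtain ⟨u, hu, hx⟩ := hlof p x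
    obtain ⟨v, hv, hy⟩ := hlof q y
    rw [hx, hy, hmul, hmul, S.map_skew π hπ hu hv, neg_add_cancel_right]
  · intro a
    obtain ⟨u, rfl⟩ := hsurj a
    rw [hd, hd, S.d_d, map_zero]
  · intro p x b
    obtain ⟨u, hu, hx⟩ := hlof p x
    obtain ⟨v, rfl⟩ := hsurj b
    rw [hx, hmul, hd, hd, hd, hmul, hmul, S.d_Y p _ u hu, map_add, LinearMap.map_negOnePow_smul,
      show p - 2 * -1 - 2 = p by ring]
  · intro p q x y
    obtain ⟨u, hu, hx⟩ := hlof p x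
    obtain ⟨v, hv, hy⟩ := hlof q y
    rw [hx, hy, hbr, hbr, S.map_skew π hπ hu hv, add_zero, Int.negOnePow_succ, sgn,
      Units.neg_smul]
  · intro p q x y c
    obtain ⟨u, hu, hx⟩ := hlof p x
    obtain ⟨v, hv, hy⟩ := hlof q y
    obtain ⟨w, rfl⟩ := hsurj c
    rw [hx, hy, hbr, hbr, hbr, hbr, hbr, hbr, S.Y_zero_Y hu hv, map_add,
      LinearMap.map_negOnePow_smul, sgn]
  · intro p q x y c
    obtain ⟨u, hu, hx⟩ := hlof p x
    obtain ⟨v, hv, hy⟩ := hlof q y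
    obtain ⟨w, rfl⟩ := hsurj c
    rw [hx, hy, hmul, hbr, hbr, hbr, hmul, hmul, S.Y_zero_Y hu hv, map_add,
      LinearMap.map_negOnePow_smul, sgn']
  · intro p x b
    obtain ⟨u, hu, hx⟩ := hlof p x
    obtain ⟨v, rfl⟩ := hsurj b
    rw [hx, hbr, hd, hd, hd, hbr, hbr, S.d_Y p _ u hu, map_add, LinearMap.map_negOnePow_smul,
      show p - 2 * 0 - 2 = p + -2 by ring, sgn2, one_smul]

end DGVertexAlgebra

/-! ### Assembling the structure on gr A(V). -/

namespace DGVertexOperatorAlgebra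

variable {V : Type*} [AddCommGroup V] [Module ℂ V] (S : DGVertexOperatorAlgebra V)

/-- The dg Poisson structure on `gr A(V)` induced by `u_(-1) v`, `u_0 v` and `d`. -/
theorem exists_grZhu_dgPoissonAlgebra : ∃ P : DGPoissonAlgebra S.grZhu (-2),
    P.one = S.grMap S.vac ∧
    (∀ u v, P.mul (S.grMap u) (S.grMap v) = S.grMap (S.Y u (-1) v)) ∧
    (∀ u v, P.bracket (S.grMap u) (S.grMap v) = S.grMap (S.Y u 0 v)) ∧
    (∀ u, P.d (S.grMap u) = S.grMap (S.d u)) := by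
  have key := S.exists_dgPoissonAlgebra (G := S.grZhu) S.grMap
  exact key S.grMap_Y_neg_two_sub S.grMap_surjective
    (fun _ _ hu => S.grMap_mem_range hu) S.exists_grMap_eq_lof S.grMap_Y_eq_zero
    (fun _ => S.grMap_d_eq_zero)

theorem grMap_eq_symb {p : ℤ} {v : V} (hv : v ∈ S.deg p) (x : S.zhuF p)
    (h : S.cls v - x ∈ S.zhuF (p - 1)) : S.grMap v = S.symb p x := by
  rw [S.grMap_of_mem hv, symbCls, S.symb_eq_symb]
  exact h

end DGVertexOperatorAlgebra

end

theorem mainTheorem4 {V : Type*} [AddCommGroup V] [Module ℂ V]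
    (S : DGVertexOperatorAlgebra V) :
    -- the product `∗` and the differential are well defined on `A(V)`
    ∃ (star : S.Zhu →ₗ[ℂ] S.Zhu →ₗ[ℂ] S.Zhu) (dA : S.Zhu →ₗ[ℂ] S.Zhu),
      (∀ (k : ℤ), ∀ u ∈ S.weightSpace k, ∀ v : V,
        star (S.cls u) (S.cls v) = S.cls (S.zhuStar k u v)) ∧
      (∀ v : V, dA (S.cls v) = S.cls (S.d v)) ∧
      -- every class of degree `p` has a preimage in `V^[p]`
      (∀ (p : ℤ) (x : S.zhuF p), ∃ u : S.deg p, S.symbCls p u = S.symb p x) ∧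
      -- the dg Poisson structure on `gr A(V)`
      ∃ P : DGPoissonAlgebra S.grZhu (-2),
        P.one = S.symbCls 0 ⟨S.vac, S.vac_mem⟩ ∧
        -- the product is induced by `∗`
        (∀ (p q : ℤ) (x : S.zhuF p) (y : S.zhuF q),
          ∃ h : star (x : S.Zhu) (y : S.Zhu) ∈ S.zhuF (p + q),
            P.mul (S.symb p x) (S.symb q y)
              = S.symb (p + q) ⟨star (x : S.Zhu) (y : S.Zhu), h⟩) ∧
        -- the differential is induced by that of `V`
        (∀ (p : ℤ) (x : S.zhuF p), ∃ h : dA (x : S.Zhu) ∈ S.zhuF (p + 1),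
          P.d (S.symb p x) = S.symb (p + 1) ⟨dA (x : S.Zhu), h⟩) ∧
        -- the bracket is the super commutator of any homogeneous preimages
        (∀ (p q : ℤ) (x : S.zhuF p) (y : S.zhuF q) (u : S.deg p) (v : S.deg q),
          S.cls u - x ∈ S.zhuF (p - 1) → S.cls v - y ∈ S.zhuF (q - 1) →
          ∃ h : star (S.cls u) (S.cls v) - (p * q).negOnePow • star (S.cls v) (S.cls u)
              ∈ S.zhuF (p + q - 2),
            P.bracket (S.symb p x) (S.symb q y) = S.symb (p + q - 2)
              ⟨star (S.cls u) (S.cls v) - (p * q).negOnePow • star (S.cls v) (S.cls u), h⟩) ∧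
        -- explicit formulas for the product and the bracket
        (∀ (p q : ℤ) (u : S.deg p) (v : S.deg q),
          (∃ h : S.Y (u : V) (-1) (v : V) ∈ S.deg (p + q),
            P.mul (S.symbCls p u) (S.symbCls q v)
              = S.symbCls (p + q) ⟨S.Y (u : V) (-1) (v : V), h⟩) ∧
          (∃ h : S.Y (u : V) 0 (v : V) ∈ S.deg (p + q - 2),
            P.bracket (S.symbCls p u) (S.symbCls q v)
              = S.symbCls (p + q - 2) ⟨S.Y (u : V) 0 (v : V), h⟩)) := by
  obtain ⟨star, hstar⟩ := LinearMap.exists_lift₂_of_surjective S.cls S.cls_surjective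
    ((S.zres 0 (-1)).compr₂ S.cls)
    (fun u v h => S.cls_eq_zero.2
      (S.zres_mem_zhuO_left (Or.inl ⟨rfl, rfl⟩) v (S.cls_eq_zero.1 h)))
    (fun u v h => S.cls_eq_zero.2
      (S.zres_mem_zhuO_right (Or.inl ⟨rfl, rfl⟩) u (S.cls_eq_zero.1 h)))
  obtain ⟨dA, hdA⟩ := LinearMap.exists_lift_of_surjective S.cls S.cls_surjective
    (S.cls ∘ₗ S.d) (fun u h => S.cls_eq_zero.2 (S.d_mem_zhuO (S.cls_eq_zero.1 h)))
  simp only [LinearMap.compr₂_apply, LinearMap.comp_apply] at hstar hdA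
  obtain ⟨P, hone, hmul, hbr, hd⟩ :=
    S.exists_grZhu_dgPoissonAlgebra
  have hY1 : ∀ {p q : ℤ} {u v : V}, u ∈ S.deg p → v ∈ S.deg q → S.Y u (-1) v ∈ S.deg (p + q) :=
    fun {p q u v} hu hv => by simpa using S.Y_mem p q (-1) u hu v hv
  have hY0 : ∀ {p q : ℤ} {u v : V}, u ∈ S.deg p → v ∈ S.deg q →
      S.Y u 0 v ∈ S.deg (p + q - 2) :=
    fun {p q u v} hu hv => by simpa using S.Y_mem p q 0 u hu v hv
  have hF : ∀ {p q : ℤ} {x y : S.Zhu}, x ∈ S.zhuF p → y ∈ S.zhuF q →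
      star x y ∈ S.zhuF (p + q) := by
    intro p q x y hx hy
    obtain ⟨u, rfl⟩ := S.cls_surjective x
    obtain ⟨v, rfl⟩ := S.cls_surjective y
    rw [hstar]
    exact S.cls_zres_mem_zhuF (Or.inl ⟨rfl, rfl⟩) hx hy (by omega)
  have hFd : ∀ {p : ℤ} {x : S.Zhu}, x ∈ S.zhuF p → dA x ∈ S.zhuF (p + 1) := by
    intro p x hx
    obtain ⟨w, hw, rfl⟩ := S.exists_mem_fil hx
    rw [hdA]
    exact S.cls_mem_zhuF (S.fil_induction (C := fun w => S.d w ∈ S.fil (p + 1))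
      (fun q hq w hw => S.mem_fil (by omega) (S.d_mem q w hw)) (by simp)
      (fun w w' h h' => by rw [map_add]; exact add_mem h h') hw)
  refine ⟨star, dA, fun k u hu v => by rw [hstar, S.zres_zero_neg_one hu], hdA,
    S.exists_symbCls_eq, P, by rw [hone, S.grMap_of_mem S.vac_mem], ?_, ?_, ?_, ?_⟩
  · intro p q x y
    refine ⟨hF x.2 y.2, ?_⟩
    obtain ⟨⟨u, hu⟩, hx⟩ := S.exists_symbCls_eq p x
    obtain ⟨⟨v, hv⟩, hy⟩ := S.exists_symbCls_eq q y
    rw [← hx, ← hy, ← S.grMap_of_mem hu, ← S.grMap_of_mem hv, hmul]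
    refine S.grMap_eq_symb (hY1 hu hv) _ ?_
    rw [DGVertexOperatorAlgebra.symbCls, S.symb_eq_symb] at hx hy
    -- The three errors, from truncating ∗ to its leading mode and from replacing x and then y by
    -- homogeneous representatives, each lie in F^(p+q-1).
    have e : S.cls (S.Y u (-1) v) - star (x : S.Zhu) (y : S.Zhu)
        = -S.cls (S.zres 0 (-1) u v - S.Y u (-1) v) + star (S.cls u - x) (S.cls v)
          + star (x : S.Zhu) (S.cls v - y) := by
      rw [map_sub, map_sub, map_sub, LinearMap.sub_apply, hstar]
      abel
    rw [e]
    refine add_mem (add_mem (neg_mem (S.cls_mem_zhuF (S.zres_sub_mem_fil hu hv _ _ (by omega)))) ?_)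
      ?_
    · exact S.zhuF_mono (by omega) (hF hx (S.cls_mem hv))
    · exact S.zhuF_mono (by omega) (hF x.2 hy)
  · intro p x
    refine ⟨hFd x.2, ?_⟩
    obtain ⟨⟨u, hu⟩, hx⟩ := S.exists_symbCls_eq p x
    rw [← hx, ← S.grMap_of_mem hu, hd]
    refine S.grMap_eq_symb (S.d_mem p u hu) _ ?_
    rw [DGVertexOperatorAlgebra.symbCls, S.symb_eq_symb] at hx
    rw [← hdA, ← map_sub]
    exact S.zhuF_mono (by omega) (hFd hx)
  · rintro p q x y ⟨u, hu⟩ ⟨v, hv⟩ hx hy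
    -- Written as a single residue with leading mode u_0 v, the supercommutator visibly lies in
    -- F^(p+q-2).
    have hc : star (S.cls u) (S.cls v) - (p * q).negOnePow • star (S.cls v) (S.cls u)
        = S.cls (S.zres (-1) 0 u v) := by
      rw [hstar, hstar, S.cls_zres_commutator hu hv]
    have h : star (S.cls u) (S.cls v) - (p * q).negOnePow • star (S.cls v) (S.cls u)
        ∈ S.zhuF (p + q - 2) := by
      rw [hc]
      exact S.cls_zres_mem_zhuF (Or.inr ⟨rfl, rfl⟩) (S.cls_mem hu) (S.cls_mem hv) (by omega)
    refine ⟨h, ?_⟩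
    rw [← S.grMap_eq_symb hu x hx, ← S.grMap_eq_symb hv y hy, hbr]
    refine S.grMap_eq_symb (hY0 hu hv) _ ?_
    simp only
    rw [hc, ← map_sub, ← neg_mem_iff, ← map_neg, neg_sub]
    exact S.cls_mem_zhuF (S.zres_sub_mem_fil hu hv _ _ (by omega))
  · rintro p q ⟨u, hu⟩ ⟨v, hv⟩
    refine ⟨⟨hY1 hu hv, ?_⟩, ⟨hY0 hu hv, ?_⟩⟩
    · rw [← S.grMap_of_mem hu, ← S.grMap_of_mem hv, hmul, S.grMap_of_mem (hY1 hu hv)]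
    · rw [← S.grMap_of_mem hu, ← S.grMap_of_mem hv, hbr, S.grMap_of_mem (hY0 hu hv)]
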